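/- Let $\mathsf X=\mathsf X_u\times\mathsf X_n$ be a finite product set, and let $P_0(x,x')=R_0(x,x_u')\,Q_0(x,x_n')$, $x'=(x_u',x_n')$, be an irreducible, aperiodic transition matrix on $\mathsf X$, where $R_0(x,\cdot)$ and $Q_0(x,\cdot)$ are probability mass functions (pmfs) on $\mathsf X_u$ and $\mathsf X_n$. Let $\mathcal U:\mathsf X\to\mathbb R$ (power consumption) and $x^\circ\in\mathsf X$. Transition matrices $P$ with $P(x,x')=R(x,x_u')Q_0(x,x_n')$, $\sum_{x_u'}R(x,x_u')=1$, are called admissible. For $h^\circ:\mathsf X\to\mathbb R$ put $h(x,x_u')=\sum_{x_n'}Q_0(x,x_n')h^\circ(x_u',x_n')$ and let $$P_{h}(x,x')=P_0(x,x')\exp\bigl(h(x,x_u')-\Lambda_h(x)\bigr),\qquad \Lambda_h(x)=\log\sum_{x'}P_0(x,x')e^{h(x,x_u')} .$$ For irreducible $P$ with invariant pmf $\pi$ let $Z=[I-P+1\otimes\pi]^{-1}$ and $\mathcal H^\circ(P)(x)=\sum_{x'}[Z(x,x')-Z(x^\circ,x')]\,\mathcal U(x')$. The Individual Perspective Design (IPD)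 is the ODE $$\tfrac{d}{d\zeta}h^\circ_\zeta=\mathcal H^\circ(P_\zeta),\qquad h^\circ_0=0,\qquad P_\zeta=P_{h_\zeta},\quad \zeta\in\mathbb R,$$ with $h_\zeta$ obtained from $h_\zeta^\circ$ as above. Let $$K(P\|P_0)=\sum_{x,x'}\pi(x)P(x,x')\log\frac{P(x,x')}{P_0(x,x')}\in(-\infty,\infty],\qquad \eta^*_\zeta=\max_{\pi,P}\{\zeta\pi(\mathcal U)-K(P\|P_0):\pi P=\pi\},$$ the maximum being over admissible $P$ and invariant pmfs $\pi$ of $P$, and let $\check P_\zeta$ be a maximizing $P$. Theorem. The ODE has exactly one solution on all of $\mathbb R$; $h_\zeta$ is continuously differentiable in $\zeta$. For every $\zeta$, $P_\zeta$ is an irreducible and aperiodic transition matrix, so it has a unique invariant pmf $\pi_\zeta$; the matrix $I-P_\zeta+1\otimes\pi_\zeta$ is invertible; and, with $\bar{\mathcal U}_\zeta=\pi_\zeta(\mathcal U)$, the function $H^\circ=\mathcal H^\circ(P_\zeta)$ is the unique solution of Poisson's equation $P_\zeta H^\circ=H^\circ-\mathcal U+\bar{\mathcal U}_\zeta$ with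 $H^\circ(x^\circ)=0$. Moreover, for every $\zeta$: (i) The maximum $\eta^*_\zeta$ is attained, the maximizing transition matrix is unique, and $P_\zeta=\check P_\zeta$. (ii) There is exactly one function $h^*_\zeta:\mathsf X\to\mathbb R$ with $h^*_\zeta(x^\circ)=0$ for which $(h^*_\zeta,\eta^*_\zeta)$ solves the average reward optimality equation $$\max_{P}\Bigl\{\zeta\,\mathcal U(x)-\sum_{x'}P(x,x')\log\frac{P(x,x')}{P_0(x,x')}+\sum_{x'}P(x,x')h^*_\zeta(x')\Bigr\}=h^*_\zeta(x)+\eta^*_\zeta,\qquad x\in\mathsf X,$$ (maximum over admissible $P$), and $h_\zeta(x,x_u')=\sum_{x_n'}Q_0(x,x_n')\,h^*_\zeta(x_u',x_n')$ for all $x,x_u'$. (iii) $\eta^*$ is twice differentiable, $\bar{\mathcal U}_\zeta$ is differentiable, and $$\tfrac{d}{d\zeta}\bar{\mathcal U}_\zeta=\tfrac{d^2}{d\zeta^2}\eta^*_\zeta\ge0,$$ and hence $\bar{\mathcal U}_\zeta$ is nondecreasing in $\zeta$. -/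

import Mathlib

namespace IPD

open Matrix

noncomputable section

/-! ### Finite-state Markov chains -/

/-- `π` is an invariant probability mass function of the matrix `P`. -/
def IsInvariantPmf {X : Type*} [Fintype X] (P : Matrix X X ℝ) (π : X → ℝ) : Prop :=
  π ∈ stdSimplex ℝ X ∧ π ᵥ* P = π

/-- The invariant pmf of `P` (meaningful when `P` has exactly one). -/
def invPmf {X : Type*} [Fintype X] (P : Matrix X X ℝ) : X → ℝ :=
  Classical.epsilon (IsInvariantPmf P)

/-- Aperiodicity: for each state, the return times of positive probability have no common
divisor other than `1`. -/
def IsAperiodic {X : Type*} [Fintype X] [DecidableEq X] (P : Matrix X X ℝ) : Prop :=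
  ∀ x : X, ∀ d : ℕ, (∀ n : ℕ, 0 < n → 0 < (P ^ n) x x → d ∣ n) → d = 1

/-- The steady-state mean of `U` under the invariant pmf of `P`. -/
def steadyMean {X : Type*} [Fintype X] (U : X → ℝ) (P : Matrix X X ℝ) : ℝ :=
  ∑ x, invPmf P x * U x

/-- The matrix `I - P + 1 ⊗ π`, where `π` is the invariant pmf of `P`. -/
def preFundamental {X : Type*} [Fintype X] [DecidableEq X] (P : Matrix X X ℝ) : Matrix X X ℝ :=
  1 - P + Matrix.of (fun _ x' => invPmf P x')

/-- The fundamental matrix `Z = (I - P + 1 ⊗ π)⁻¹`. -/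
def fundamental {X : Type*} [Fintype X] [DecidableEq X] (P : Matrix X X ℝ) : Matrix X X ℝ :=
  (preFundamental P)⁻¹

/-- `log (p / q)` as an extended real, equal to `+∞` when `q = 0`. It is used only with a
factor `p` in front, so that `0 * log (0 / q) = 0` for every `q`. -/
def logRatio (p q : ℝ) : EReal :=
  if q = 0 then ⊤ else (Real.log (p / q) : EReal)

/-- The Donsker-Varadhan relative entropy rate
`K(P ‖ P₀) = ∑ π(x) P(x,x') log (P(x,x') / P₀(x,x'))`, with values in the extended reals. -/
def relEntropyRate {X : Type*} [Fintype X] (π : X → ℝ) (P P₀ : Matrix X X ℝ) : EReal :=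
  ∑ x, ∑ x', ((π x * P x x' : ℝ) : EReal) * logRatio (P x x') (P₀ x x')

/-- The twisted transition matrix `P₀(x,x') exp (h(x,x') - Λ_h(x))`, where
`Λ_h(x) = log ∑ P₀(x,x') exp (h(x,x'))`. -/
def twist {X : Type*} [Fintype X] (P₀ : Matrix X X ℝ) (h : X → X → ℝ) : Matrix X X ℝ :=
  Matrix.of fun x x' =>
    P₀ x x' * Real.exp (h x x' - Real.log (∑ y, P₀ x y * Real.exp (h x y)))

/-! ### The nature / nurture structure: the state is `x = (x_u, x_n)` -/

section NatureNurture

variable {Xu Xn : Type*} [Fintype Xu] [Fintype Xn] [DecidableEq Xu] [DecidableEq Xn]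

/-- The matrix `P(x, x') = R(x, x_u') Q(x, x_n')`. -/
def product (R : Xu × Xn → Xu → ℝ) (Q : Xu × Xn → Xn → ℝ) :
    Matrix (Xu × Xn) (Xu × Xn) ℝ :=
  Matrix.of fun x x' => R x x'.1 * Q x x'.2

/-- The transition matrices `P(x, x') = R(x, x_u') Q₀(x, x_n')` with `Q₀` given. -/
def admissible (Q₀ : Xu × Xn → Xn → ℝ) : Set (Matrix (Xu × Xn) (Xu × Xn) ℝ) :=
  {P | P ∈ rowStochastic ℝ (Xu × Xn) ∧
    ∃ R : Xu × Xn → Xu → ℝ, (∀ x, ∑ u, R x u = 1) ∧ P = product R Q₀}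

/-- The `Q₀`-average `∑_{x_n'} Q₀(x, x_n') g(x_u', x_n')`, a function of `(x, x_u')`. -/
def average (Q₀ : Xu × Xn → Xn → ℝ) (g : Xu × Xn → ℝ) : Xu × Xn → Xu → ℝ :=
  fun x u => ∑ n, Q₀ x n * g (u, n)

/-- The transition matrix determined by `g : X → ℝ`: the twist of `P₀ = R₀ Q₀` by the
function `h(x, x') = h(x, x_u')`, the `Q₀`-average of `g`. -/
def designMatrix (R₀ : Xu × Xn → Xu → ℝ) (Q₀ : Xu × Xn → Xn → ℝ) (g : Xu × Xn → ℝ) :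
    Matrix (Xu × Xn) (Xu × Xn) ℝ :=
  twist (product R₀ Q₀) (fun x x' => average Q₀ g x x'.1)

/-- The map `P ↦ H°` of the Individual Perspective Design:
`H°(x) = ∑ [Z(x,x') - Z(x°,x')] U(x')`. -/
def ipdMap {X : Type*} [Fintype X] [DecidableEq X] (U : X → ℝ) (x₀ : X) (P : Matrix X X ℝ) :
    X → ℝ :=
  fun x => ∑ x', (fundamental P x x' - fundamental P x₀ x') * U x'

/-- `h° : ℝ → (X → ℝ)` solves, on the whole line, the ODE
`d/dζ h°_ζ = H°(P_ζ)`, `h°_0 = 0`, where `P_ζ` is determined by `h°_ζ`. -/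
def IsIPDSolution (R₀ : Xu × Xn → Xu → ℝ) (Q₀ : Xu × Xn → Xn → ℝ) (U : Xu × Xn → ℝ)
    (x₀ : Xu × Xn) (h : ℝ → Xu × Xn → ℝ) : Prop :=
  h 0 = 0 ∧ ∀ ζ : ℝ, HasDerivAt h (ipdMap U x₀ (designMatrix R₀ Q₀ (h ζ))) ζ

/-- The pairs `(π, P)` with `P` a transition matrix of the form `R Q₀` and `π` an invariant
pmf of `P`. -/
def feasible (Q₀ : Xu × Xn → Xn → ℝ) : Set ((Xu × Xn → ℝ) × Matrix (Xu × Xn) (Xu × Xn) ℝ) :=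
  {p | p.2 ∈ admissible Q₀ ∧ IsInvariantPmf p.2 p.1}

/-- The objective `ζ π(U) - K(P ‖ P₀)`. -/
def objective (P₀ : Matrix (Xu × Xn) (Xu × Xn) ℝ) (U : Xu × Xn → ℝ) (ζ : ℝ)
    (p : (Xu × Xn → ℝ) × Matrix (Xu × Xn) (Xu × Xn) ℝ) : EReal :=
  ((ζ * ∑ x, p.1 x * U x : ℝ) : EReal) - relEntropyRate p.1 p.2 P₀

/-- The optimal reward `η*_ζ`. -/
def optimalReward (R₀ : Xu × Xn → Xu → ℝ) (Q₀ : Xu × Xn → Xn → ℝ) (U : Xu × Xn → ℝ)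
    (ζ : ℝ) : ℝ :=
  (sSup (objective (product R₀ Q₀) U ζ '' feasible Q₀)).toReal

/-- The set of all maximizing transition matrices (the `arg max` over `P`). -/
def optimalMatrices (R₀ : Xu × Xn → Xu → ℝ) (Q₀ : Xu × Xn → Xn → ℝ) (U : Xu × Xn → ℝ)
    (ζ : ℝ) : Set (Matrix (Xu × Xn) (Xu × Xn) ℝ) :=
  {P | ∃ π, (π, P) ∈ feasible Q₀ ∧
    IsMaxOn (objective (product R₀ Q₀) U ζ) (feasible Q₀) (π, P)}

/-- The one-step reward `ζ U(x) - ∑ P(x,x') log (P(x,x') / P₀(x,x'))`. -/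
def oneStepReward (P₀ : Matrix (Xu × Xn) (Xu × Xn) ℝ) (U : Xu × Xn → ℝ) (ζ : ℝ)
    (x : Xu × Xn) (P : Matrix (Xu × Xn) (Xu × Xn) ℝ) : EReal :=
  ((ζ * U x : ℝ) : EReal) - ∑ x', (P x x' : EReal) * logRatio (P x x') (P₀ x x')

/-- The average reward optimality equation for `(g, η)`: for each `x`, the maximum over `P` of
the one-step reward plus `∑ P(x,x') g(x')` is attained and equals `g(x) + η`. -/
def SolvesAROE (R₀ : Xu × Xn → Xu → ℝ) (Q₀ : Xu × Xn → Xn → ℝ) (U : Xu × Xn → ℝ)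
    (ζ : ℝ) (g : Xu × Xn → ℝ) (η : ℝ) : Prop :=
  ∀ x, IsGreatest
    ((fun P : Matrix (Xu × Xn) (Xu × Xn) ℝ =>
      oneStepReward (product R₀ Q₀) U ζ x P + ((∑ x', P x x' * g x' : ℝ) : EReal)) ''
        admissible Q₀)
    ((g x + η : ℝ) : EReal)

end NatureNurture

end

end IPD

/-! Write Λ for `logPartition`. Along the ODE, dΛ(x)/dζ = (P_ζ H°)(x), so Poisson's equation makes
the derivative of ζ U(x) + Λ(x) - h°(x) equal to the steady-state mean, whatever x is
(`hasDerivAt_reward`). This quantity is 0 at ζ = 0 for every x, hence never depends on x: it is a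
number η_ζ, and (h°_ζ, η_ζ) solves the optimality equation in log-sum-exp form
(`aroe_of_integralCurve`, `solvesAROE_iff`).

The Gibbs identity `mulVec_sub_sum_log`, integrated against an invariant pmf, then writes the
objective as η_ζ minus a weighted relative entropy to P_ζ (`objective_eq`). So η_ζ is the maximum,
P_ζ the only maximizer, and the derivative of η* is the mean. Monotonicity follows because η* is a
supremum of functions affine in ζ, with the mean as a subgradient.

Global existence needs a C¹ field and an a priori bound. Smoothness comes from Cramer's rule for the
matrix `pinned`, which does not involve π. The bound |h°_ζ| ≤ C|ζ| holds for every normalized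
solution of the optimality equation (`exists_norm_le_of_aroe`), by a quantitative minimum principle
for P₀. -/

namespace IPD

open Matrix Finset

/-! ### Finite Markov chains: minimum principle, invariant pmf, Poisson's equation. -/

section Markov

variable {X : Type*} [Fintype X] [DecidableEq X] {P : Matrix X X ℝ}

theorem mulVec_mono_of_rowStochastic (hP : P ∈ rowStochastic ℝ X) {f g : X → ℝ}
    (h : ∀ x, f x ≤ g x) (x : X) : (P *ᵥ f) x ≤ (P *ᵥ g) x :=
  Finset.sum_le_sum fun y _ =>
    mul_le_mul_of_nonneg_left (h y) (nonneg_of_mem_rowStochastic hP)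

theorem mulVec_add_const (hP : P ∈ rowStochastic ℝ X) (f : X → ℝ) (c : ℝ) (x : X) :
    (P *ᵥ fun y => f y + c) x = (P *ᵥ f) x + c := by
  simp only [mulVec, dotProduct, mul_add, sum_add_distrib, ← Finset.sum_mul,
    sum_row_of_mem_rowStochastic hP, one_mul]

theorem mulVec_pow_sub_le (hP : P ∈ rowStochastic ℝ X) {f : X → ℝ} {c : ℝ}
    (h : ∀ x, (P *ᵥ f) x - c ≤ f x) (n : ℕ) (x : X) : ((P ^ n) *ᵥ f) x - n * c ≤ f x := by
  induction n generalizing x with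
  | zero => simp
  | succ n ih =>
    have h1 := mulVec_mono_of_rowStochastic hP (f := fun y => ((P ^ n) *ᵥ f) y + -(n * c))
      (g := f) (fun y => by simpa [sub_eq_add_neg] using ih y) x
    rw [mulVec_add_const hP, mulVec_mulVec, ← pow_succ'] at h1
    have := h x
    push_cast
    linarith

/-- A minorant for the growth of a function with `P f - c ≤ f` away from its minimum. -/
theorem pow_apply_mul_sub_le (hP : P ∈ rowStochastic ℝ X) {f : X → ℝ} {c : ℝ}
    (h : ∀ x, (P *ᵥ f) x - c ≤ f x) {y : X} (hy : ∀ x, f y ≤ f x) (n : ℕ) (z : X) :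
    (P ^ n) y z * (f z - f y) ≤ n * c := by
  have hPn : P ^ n ∈ rowStochastic ℝ X := pow_mem hP n
  have h1 := mulVec_pow_sub_le hP h n y
  have h2 : (P ^ n) y z * (f z - f y) ≤ ∑ w, (P ^ n) y w * (f w - f y) :=
    Finset.single_le_sum (f := fun w => (P ^ n) y w * (f w - f y))
      (fun w _ => mul_nonneg (nonneg_of_mem_rowStochastic hPn) (sub_nonneg.2 (hy w)))
      (mem_univ z)
  have h3 : ∑ w, (P ^ n) y w * (f w - f y) = ((P ^ n) *ᵥ f) y - f y := by
    simp only [mul_sub, sum_sub_distrib, ← Finset.sum_mul, sum_row_of_mem_rowStochastic hPn,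
      one_mul]
    rfl
  linarith

/-- Minimum principle: with zero drift, a power of P charging z from the minimizer forces f z to
equal the minimum. -/
theorem eq_of_superharmonic (hP : P ∈ rowStochastic ℝ X) (hirr : P.IsIrreducible) {f : X → ℝ}
    (h : ∀ x, (P *ᵥ f) x ≤ f x) (x y : X) : f x = f y := by
  have : Nonempty X := ⟨x⟩
  obtain ⟨m, hm⟩ := Finite.exists_min f
  have key : ∀ z, f z = f m := by
    intro z
    obtain ⟨k, -, hk⟩ := (isIrreducible_iff_exists_pow_pos hirr.nonneg).1 hirr m z
    have h1 := pow_apply_mul_sub_le hP (c := 0) (by simpa using h) hm k z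
    rw [mul_zero] at h1
    have := nonpos_of_mul_nonpos_right h1 hk
    linarith [hm z]
  rw [key x, key y]

omit [DecidableEq X] in
theorem sum_mul_mulVec {π : X → ℝ} (hπ : π ᵥ* P = π) (f : X → ℝ) :
    ∑ x, π x * (P *ᵥ f) x = ∑ x, π x * f x := by
  change π ⬝ᵥ (P *ᵥ f) = π ⬝ᵥ f
  rw [dotProduct_mulVec, hπ]

/-- Constants lie in the right kernel of 1 - P, so there is a left null vector v. Entrywise |v| ≤
|v|P, and both sides have the same total mass, so |v| is invariant and only needs normalizing. -/
theorem exists_isInvariantPmf [Nonempty X] (hP : P ∈ rowStochastic ℝ X) :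
    ∃ π, IsInvariantPmf P π := by
  have hker : ∃ v ≠ 0, (1 - P) *ᵥ v = 0 :=
    ⟨1, one_ne_zero, by rw [sub_mulVec, one_mulVec, one_vecMul_of_mem_rowStochastic hP, sub_self]⟩
  rw [exists_mulVec_eq_zero_iff, ← exists_vecMul_eq_zero_iff] at hker
  obtain ⟨v, hv0, hv⟩ := hker
  rw [vecMul_sub, vecMul_one, sub_eq_zero] at hv
  have hle : ∀ y, |v y| ≤ ((fun x => |v x|) ᵥ* P) y := by
    intro y
    calc |v y| = |∑ x, v x * P x y| := congrArg abs (congrFun hv y)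
      _ ≤ ∑ x, |v x * P x y| := Finset.abs_sum_le_sum_abs _ _
      _ = ∑ x, |v x| * P x y := by
        refine Finset.sum_congr rfl fun x _ => ?_
        rw [abs_mul, abs_of_nonneg (nonneg_of_mem_rowStochastic hP)]
  have hsum : ∑ y, ((fun x => |v x|) ᵥ* P) y = ∑ y, |v y| := by
    simp only [vecMul, dotProduct]
    rw [Finset.sum_comm]
    simp only [← Finset.mul_sum, sum_row_of_mem_rowStochastic hP, mul_one]
  have heq : ∀ y, |v y| = ((fun x => |v x|) ᵥ* P) y := fun y =>
    (Finset.sum_eq_sum_iff_of_le fun y _ => hle y).1 hsum.symm y (mem_univ y)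
  have hpos : 0 < ∑ y, |v y| := by
    obtain ⟨x, hx⟩ := Function.ne_iff.1 hv0
    exact Finset.sum_pos' (fun _ _ => abs_nonneg _) ⟨x, mem_univ x, abs_pos.2 hx⟩
  refine ⟨(∑ y, |v y|)⁻¹ • fun x => |v x|, ⟨fun x => ?_, ?_⟩, ?_⟩
  · exact mul_nonneg (inv_nonneg.2 hpos.le) (abs_nonneg _)
  · simp only [Pi.smul_apply, smul_eq_mul, ← Finset.mul_sum]
    exact inv_mul_cancel₀ hpos.ne'
  · rw [smul_vecMul]
    congr 1
    funext y
    exact (heq y).symm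

theorem IsInvariantPmf.pos {π : X → ℝ} (hπ : IsInvariantPmf P π) (hirr : P.IsIrreducible)
    (z : X) : 0 < π z := by
  have hpow : ∀ n : ℕ, π ᵥ* P ^ n = π := by
    intro n
    induction n with
    | zero => simp
    | succ n ih => rw [pow_succ, ← vecMul_vecMul, ih, hπ.2]
  obtain ⟨x, -, hx⟩ : ∃ x ∈ univ, 0 < π x := by
    by_contra! hc
    have := Finset.sum_nonpos hc
    rw [hπ.1.2] at this
    linarith
  obtain ⟨k, -, hk⟩ := (isIrreducible_iff_exists_pow_pos hirr.nonneg).1 hirr x z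
  rw [← congrFun (hpow k) z]
  refine lt_of_lt_of_le (mul_pos hx hk)
    (Finset.single_le_sum (f := fun w => π w * (P ^ k) w z) (fun w _ => mul_nonneg (hπ.1.1 w) ?_)
      (mem_univ x))
  exact pow_apply_nonneg hirr.nonneg k w z

/-- The matrix `I - P + 1 ⊗ δ_{x₀}`. -/
def pinned (x₀ : X) (P : Matrix X X ℝ) : Matrix X X ℝ :=
  1 - P + Matrix.of (fun _ y => if y = x₀ then 1 else 0)

theorem pinned_mulVec (x₀ : X) (f : X → ℝ) (x : X) :
    (pinned x₀ P *ᵥ f) x = f x - (P *ᵥ f) x + f x₀ := by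
  rw [pinned, add_mulVec, sub_mulVec, one_mulVec]
  simp [mulVec, dotProduct]

theorem preFundamental_mulVec (f : X → ℝ) (x : X) :
    (preFundamental P *ᵥ f) x = f x - (P *ᵥ f) x + ∑ y, invPmf P y * f y := by
  rw [preFundamental, add_mulVec, sub_mulVec, one_mulVec]
  simp [mulVec, dotProduct]

theorem isUnit_of_mulVec_eq_zero {A : Matrix X X ℝ} (h : ∀ f, A *ᵥ f = 0 → f = 0) : IsUnit A := by
  rw [isUnit_iff_isUnit_det, isUnit_iff_ne_zero]
  intro h0
  obtain ⟨v, hv, hv0⟩ := exists_mulVec_eq_zero_iff.2 h0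
  exact hv (h v hv0)

variable (hP : P ∈ rowStochastic ℝ X) (hirr : P.IsIrreducible)
include hP

theorem isInvariantPmf_invPmf [Nonempty X] : IsInvariantPmf P (invPmf P) :=
  Classical.epsilon_spec (exists_isInvariantPmf hP)

include hirr

/-- For f in the kernel, pairing with π removes f - Pf and leaves f x₀ = 0; then f is harmonic,
hence constant. With a point mass in place of π the matrix is affine in P, which makes dependence on
P easy to differentiate. -/
theorem isUnit_pinned (x₀ : X) : IsUnit (pinned x₀ P) := by
  have : Nonempty X := ⟨x₀⟩
  refine isUnit_of_mulVec_eq_zero fun f hf => ?_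
  have hx : ∀ x, f x - (P *ᵥ f) x + f x₀ = 0 := fun x => by
    rw [← pinned_mulVec, hf, Pi.zero_apply]
  have hπ := isInvariantPmf_invPmf hP
  have h0 : f x₀ = 0 := by
    have h1 : ∑ x, invPmf P x * (f x - (P *ᵥ f) x + f x₀) = 0 := by simp [hx]
    simp only [mul_add, mul_sub, sum_add_distrib, sum_sub_distrib, sum_mul_mulVec hπ.2,
      ← Finset.sum_mul, hπ.1.2] at h1
    linarith
  funext x
  rw [eq_of_superharmonic hP hirr (f := f) (fun x => by linarith [hx x]) x x₀, h0, Pi.zero_apply]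

theorem isUnit_preFundamental [Nonempty X] : IsUnit (preFundamental P) := by
  refine isUnit_of_mulVec_eq_zero fun f hf => ?_
  have hx : ∀ x, f x - (P *ᵥ f) x + ∑ y, invPmf P y * f y = 0 := fun x => by
    rw [← preFundamental_mulVec, hf, Pi.zero_apply]
  have hπ := isInvariantPmf_invPmf hP
  have h0 : ∑ y, invPmf P y * f y = 0 := by
    have h1 : ∑ x, invPmf P x * (f x - (P *ᵥ f) x + ∑ y, invPmf P y * f y) = 0 := by simp [hx]
    simp only [mul_add, mul_sub, sum_add_distrib, sum_sub_distrib, sum_mul_mulVec hπ.2,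
      ← Finset.sum_mul, hπ.1.2] at h1
    linarith
  funext x
  have hc := fun y => eq_of_superharmonic hP hirr (f := f) (fun x => by linarith [hx x]) y x
  rw [Finset.sum_congr rfl fun y _ => by rw [hc y], ← Finset.sum_mul, hπ.1.2, one_mul] at h0
  exact h0

theorem existsUnique_isInvariantPmf [Nonempty X] : ∃! π, IsInvariantPmf P π := by
  obtain ⟨x₀⟩ := ‹Nonempty X›
  have : Nonempty X := ⟨x₀⟩
  obtain ⟨π, hπ⟩ := exists_isInvariantPmf hP
  -- An invertible matrix sends every invariant pmf to the same point mass, which gives uniqueness.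
  have key : ∀ ν, IsInvariantPmf P ν → ν ᵥ* pinned x₀ P = fun y => if y = x₀ then 1 else 0 := by
    intro ν hν
    rw [pinned, vecMul_add, vecMul_sub, vecMul_one, hν.2, sub_self, zero_add]
    funext y
    simp only [vecMul, dotProduct, of_apply, ← Finset.sum_mul, hν.1.2, one_mul]
  exact ⟨π, hπ, fun ν hν => vecMul_injective_of_isUnit (isUnit_pinned hP hirr x₀)
    ((key ν hν).trans (key π hπ).symm)⟩

/-- The function `ipdMap U x₀ P` is the normalized solution of Poisson's equation. -/
theorem poisson_iff_eq_ipdMap (U : X → ℝ) (x₀ : X) (H : X → ℝ) :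
    (H x₀ = 0 ∧ ∀ x, (P *ᵥ H) x = H x - U x + steadyMean U P) ↔ H = ipdMap U x₀ P := by
  have : Nonempty X := ⟨x₀⟩
  have hπ := isInvariantPmf_invPmf hP
  set g := fundamental P *ᵥ U with hg
  have hG : ipdMap U x₀ P = fun x => g x + -g x₀ := by
    funext x
    rw [← sub_eq_add_neg]
    simp only [ipdMap, hg, mulVec, dotProduct, sub_mul, sum_sub_distrib]
  have hgU : preFundamental P *ᵥ g = U := by
    rw [hg, mulVec_mulVec, fundamental, mul_nonsing_inv _
      ((isUnit_iff_isUnit_det _).1 (isUnit_preFundamental hP hirr)), one_mulVec]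
  have hx : ∀ x, g x - (P *ᵥ g) x + ∑ y, invPmf P y * g y = U x := fun x => by
    rw [← preFundamental_mulVec, hgU]
  have h0 : ∑ y, invPmf P y * g y = steadyMean U P := by
    have h1 : ∑ x, invPmf P x * (g x - (P *ᵥ g) x + ∑ y, invPmf P y * g y)
        = ∑ x, invPmf P x * U x := by simp only [hx]
    simp only [mul_add, mul_sub, sum_add_distrib, sum_sub_distrib, sum_mul_mulVec hπ.2,
      ← Finset.sum_mul, hπ.1.2] at h1
    rw [steadyMean]
    linarith
  have hsol : ∀ x, (P *ᵥ ipdMap U x₀ P) x = ipdMap U x₀ P x - U x + steadyMean U P := by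
    intro x
    rw [hG, mulVec_add_const hP]
    linarith [hx x]
  constructor
  · rintro ⟨hH0, hH⟩
    funext x
    -- The difference of two solutions is harmonic, hence constant, and it vanishes at x₀.
    have := eq_of_superharmonic hP hirr (f := H - ipdMap U x₀ P) (fun x => by
      rw [mulVec_sub]
      simp only [Pi.sub_apply, hH, hsol]
      linarith) x x₀
    simp only [Pi.sub_apply, hH0] at this
    have h2 : ipdMap U x₀ P x₀ = 0 := by simp [ipdMap]
    linarith
  · rintro rfl
    exact ⟨by simp [ipdMap], hsol⟩

/-- Recovers the mean and the Poisson solution from one linear system free of π; the smoothness of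
both rests on this. -/
theorem pinned_inv_mulVec_apply_self (U : X → ℝ) (x₀ : X) :
    ((pinned x₀ P)⁻¹ *ᵥ U) x₀ = steadyMean U P ∧
      (fun x => ((pinned x₀ P)⁻¹ *ᵥ U) x + -((pinned x₀ P)⁻¹ *ᵥ U) x₀) = ipdMap U x₀ P := by
  have : Nonempty X := ⟨x₀⟩
  have hπ := isInvariantPmf_invPmf hP
  set f := (pinned x₀ P)⁻¹ *ᵥ U with hf
  have hfU : pinned x₀ P *ᵥ f = U := by
    rw [hf, mulVec_mulVec, mul_nonsing_inv _
      ((isUnit_iff_isUnit_det _).1 (isUnit_pinned hP hirr x₀)), one_mulVec]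
  have hx : ∀ x, f x - (P *ᵥ f) x + f x₀ = U x := fun x => by
    rw [← pinned_mulVec, hfU]
  have h0 : f x₀ = steadyMean U P := by
    have h1 : ∑ x, invPmf P x * (f x - (P *ᵥ f) x + f x₀)
        = ∑ x, invPmf P x * U x := by simp only [hx]
    simp only [mul_add, mul_sub, sum_add_distrib, sum_sub_distrib, sum_mul_mulVec hπ.2,
      ← Finset.sum_mul, hπ.1.2] at h1
    rw [steadyMean]
    linarith
  refine ⟨h0, (poisson_iff_eq_ipdMap hP hirr U x₀ _).1 ⟨by simp, fun x => ?_⟩⟩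
  rw [mulVec_add_const hP]
  linarith [hx x]

end Markov

/-! ### Irreducibility and aperiodicity depend only on the positivity pattern. -/

section Support

variable {X : Type*} [Fintype X] [DecidableEq X] {A B : Matrix X X ℝ}

theorem pow_apply_pos_iff (hA : ∀ i j, 0 ≤ A i j) (hB : ∀ i j, 0 ≤ B i j)
    (h : ∀ i j, 0 < A i j ↔ 0 < B i j) (n : ℕ) (i j : X) : 0 < (A ^ n) i j ↔ 0 < (B ^ n) i j := by
  induction n generalizing j with
  | zero => simp
  | succ n ih =>
    have key : ∀ {C : Matrix X X ℝ}, (∀ i j, 0 ≤ C i j) →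
        (0 < (C ^ (n + 1)) i j ↔ ∃ k, 0 < (C ^ n) i k ∧ 0 < C k j) := by
      intro C hC
      have hn : ∀ k, 0 ≤ (C ^ n) i k := fun k => pow_apply_nonneg hC n i k
      rw [pow_succ, mul_apply, Finset.sum_pos_iff_of_nonneg fun k _ => mul_nonneg (hn k) (hC k j)]
      refine exists_congr fun k => ?_
      simp only [mem_univ, true_and]
      constructor
      · intro hk
        exact ⟨lt_of_le_of_ne (hn k) fun h0 => by rw [← h0, zero_mul] at hk; exact hk.false,
          lt_of_le_of_ne (hC k j) fun h0 => by rw [← h0, mul_zero] at hk; exact hk.false⟩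
      · exact fun hk => mul_pos hk.1 hk.2
    rw [key hA, key hB]
    simp only [ih, h]

theorem isIrreducible_congr (hA : ∀ i j, 0 ≤ A i j) (hB : ∀ i j, 0 ≤ B i j)
    (h : ∀ i j, 0 < A i j ↔ 0 < B i j) : A.IsIrreducible ↔ B.IsIrreducible := by
  rw [isIrreducible_iff_exists_pow_pos hA, isIrreducible_iff_exists_pow_pos hB]
  simp only [pow_apply_pos_iff hA hB h]

theorem isAperiodic_congr (hA : ∀ i j, 0 ≤ A i j) (hB : ∀ i j, 0 ≤ B i j)
    (h : ∀ i j, 0 < A i j ↔ 0 < B i j) : IsAperiodic A ↔ IsAperiodic B := by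
  simp only [IsAperiodic, pow_apply_pos_iff hA hB h]

end Support

end IPD

namespace IPD

open Set Metric Filter Topology
open scoped NNReal

/-! ### Global integral curves from an a priori bound. -/

section ODE

/-- Coordinatewise clipping to `[-B, B]`. -/
def clip {ι : Type*} (B : ℝ) (x : ι → ℝ) : ι → ℝ := fun i => max (-B) (min B (x i))

variable {ι : Type*} [Fintype ι]

theorem lipschitzWith_clip (B : ℝ) : LipschitzWith 1 (clip B : (ι → ℝ) → ι → ℝ) := by
  refine LipschitzWith.of_dist_le_mul fun x y => ?_
  rw [NNReal.coe_one, one_mul, dist_pi_le_iff dist_nonneg]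
  intro i
  have h1 : LipschitzWith 1 fun a : ℝ => max (-B) (min B a) :=
    (LipschitzWith.id.const_min B).const_max (-B)
  refine (h1.dist_le_mul (x i) (y i)).trans ?_
  rw [NNReal.coe_one, one_mul]
  exact dist_le_pi_dist x y i

theorem norm_clip_le {B : ℝ} (hB : 0 ≤ B) (x : ι → ℝ) : ‖clip B x‖ ≤ B := by
  rw [pi_norm_le_iff_of_nonneg hB]
  intro i
  rw [Real.norm_eq_abs, abs_le]
  exact ⟨le_max_left _ _, max_le (by linarith) (min_le_left _ _)⟩

theorem clip_of_norm_le {B : ℝ} {x : ι → ℝ} (hx : ‖x‖ ≤ B) : clip B x = x := by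
  funext i
  have := abs_le.1 ((norm_le_pi_norm x i).trans hx)
  rw [clip, min_eq_right this.2, max_eq_right this.1]

theorem exists_lipschitzOnWith_closedBall {F : (ι → ℝ) → ι → ℝ} (hF : ContDiff ℝ 1 F) (B : ℝ) :
    ∃ K, LipschitzOnWith K F (closedBall 0 B) :=
  (hF.locallyLipschitz.locallyLipschitzOn (s := closedBall 0 B)).exists_lipschitzOnWith_of_compact
    (isCompact_closedBall 0 B)

theorem exists_solution_of_bounded {G : (ι → ℝ) → ι → ℝ} {K M : ℝ≥0} (hG : LipschitzWith K G)
    (hM : ∀ x, ‖G x‖ ≤ M) {T : ℝ} (hT : 0 < T) :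
    ∃ h : ℝ → ι → ℝ, h 0 = 0 ∧ ∀ t ∈ Ioo (-T) T, HasDerivAt h (G (h t)) t := by
  have h0 : (0 : ℝ) ∈ Icc (-T) T := ⟨by linarith, hT.le⟩
  have hpl : IsPicardLindelof (fun _ : ℝ => G) (⟨0, h0⟩ : Icc (-T) T) (0 : ι → ℝ)
      -- The radius M T is the farthest a curve of speed at most M can travel in time T.
      (M * T.toNNReal) 0 M K :=
    { lipschitzOnWith := fun _ _ => hG.lipschitzOnWith
      continuousOn := fun _ _ => continuousOn_const
      norm_le := fun _ _ x _ => hM x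
      mul_max_le := by simp [hT.le] }
  obtain ⟨h, hh0, hh⟩ := hpl.exists_eq_forall_mem_Icc_hasDerivWithinAt₀
  exact ⟨h, hh0, fun t ht =>
    (hh t (Ioo_subset_Icc_self ht)).hasDerivAt (Icc_mem_nhds ht.1 ht.2)⟩

/-- A `C¹` vector field whose integral curves through the origin grow at most linearly has
exactly one complete integral curve through the origin. -/
theorem existsUnique_global_solution {F : (ι → ℝ) → ι → ℝ} (hF : ContDiff ℝ 1 F) {C : ℝ}
    (hC : 0 ≤ C)
    (hb : ∀ (h : ℝ → ι → ℝ) (T : ℝ), h 0 = 0 →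
      (∀ t ∈ Ioo (-T) T, HasDerivAt h (F (h t)) t) → ∀ t ∈ Ioo (-T) T, ‖h t‖ ≤ C * |t|) :
    ∃! h : ℝ → ι → ℝ, h 0 = 0 ∧ ∀ t, HasDerivAt h (F (h t)) t := by
  have hball : ∀ (h : ℝ → ι → ℝ) (T : ℝ), h 0 = 0 →
      (∀ t ∈ Ioo (-T) T, HasDerivAt h (F (h t)) t) →
      ∀ t ∈ Ioo (-T) T, h t ∈ closedBall (0 : ι → ℝ) (C * T) := by
    intro h T h0 hd t ht
    rw [mem_closedBall_zero_iff]
    exact (hb h T h0 hd t ht).trans (mul_le_mul_of_nonneg_left (abs_le.2 ⟨ht.1.le, ht.2.le⟩) hC)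
  have huniq : ∀ (f g : ℝ → ι → ℝ) (T : ℝ), f 0 = 0 → g 0 = 0 →
      (∀ t ∈ Ioo (-T) T, HasDerivAt f (F (f t)) t) →
      (∀ t ∈ Ioo (-T) T, HasDerivAt g (F (g t)) t) → EqOn f g (Ioo (-T) T) := by
    intro f g T hf0 hg0 hf hg t ht
    obtain ⟨K, hK⟩ := exists_lipschitzOnWith_closedBall hF (C * T)
    have hT : 0 < T := by linarith [ht.1, ht.2]
    exact ODE_solution_unique_of_mem_Ioo (v := fun _ => F) (s := fun _ => closedBall 0 (C * T))
      (t₀ := 0) (fun _ _ => hK) ⟨by linarith, hT⟩ (fun t ht => ⟨hf t ht, hball f T hf0 hf t ht⟩)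
      (fun t ht => ⟨hg t ht, hball g T hg0 hg t ht⟩) (hf0.trans hg0.symm) ht
  have hex : ∀ T : ℝ, 0 < T →
      ∃ h : ℝ → ι → ℝ, h 0 = 0 ∧ ∀ t ∈ Ioo (-T) T, HasDerivAt h (F (h t)) t := by
    intro T hT
    -- Strictly above the a priori bound C T, so a curve of the clipped field cannot reach norm B.
    set B := C * T + 1 with hBdef
    have hB : 0 ≤ B := by positivity
    obtain ⟨K, hK⟩ := exists_lipschitzOnWith_closedBall hF B
    have hclip : ∀ x : ι → ℝ, clip B x ∈ closedBall (0 : ι → ℝ) B := fun x =>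
      mem_closedBall_zero_iff.2 (norm_clip_le hB x)
    obtain ⟨M, hM⟩ := (isCompact_closedBall (0 : ι → ℝ) B).exists_bound_of_continuousOn
      hF.continuous.continuousOn
    have hLip : LipschitzWith (K * 1) (F ∘ clip B) := by
      rw [← lipschitzOnWith_univ]
      exact hK.comp (lipschitzWith_clip B).lipschitzOnWith fun x _ => hclip x
    obtain ⟨h, h0, hd⟩ := exists_solution_of_bounded (M := M.toNNReal) hLip
      (fun x => (hM _ (hclip x)).trans (Real.le_coe_toNNReal M)) hT
    refine ⟨h, h0, ?_⟩
    -- First-exit argument: let r have least absolute value among times with ‖h r‖ ≥ B. Before r the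
    -- clipping is inactive, so the a priori bound gives ‖h‖ ≤ C T there and, by continuity, at r,
    -- contradicting C T < B.
    have hlt : ∀ t ∈ Ioo (-T) T, ‖h t‖ < B := by
      by_contra! hc
      obtain ⟨s, hs, hsB⟩ := hc
      have hsT : |s| < T := abs_lt.2 hs
      have hcont : ContinuousOn h (Icc (-|s|) |s|) := fun r hr =>
        (hd r ⟨by linarith [hr.1], by linarith [hr.2]⟩).continuousAt.continuousWithinAt
      have hcpt : IsCompact (Icc (-|s|) |s| ∩ (fun r => ‖h r‖) ⁻¹' Ici B) :=
        isCompact_Icc.of_isClosed_subset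
          (hcont.norm.preimage_isClosed_of_isClosed isClosed_Icc isClosed_Ici) inter_subset_left
      obtain ⟨r, ⟨hrI, hrB⟩, hrmin⟩ := hcpt.exists_isMinOn
        ⟨s, ⟨neg_abs_le s, le_abs_self s⟩, hsB⟩ continuous_abs.continuousOn
      have hrs : |r| ≤ |s| := abs_le.2 hrI
      have hin : ∀ t ∈ Ioo (-|r|) |r|, ‖h t‖ < B := by
        intro t ht
        by_contra! hcon
        have htr : |t| < |r| := abs_lt.2 ht
        have := hrmin (show t ∈ _ from ⟨abs_le.1 (htr.le.trans hrs), hcon⟩)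
        rw [mem_ofPred_eq] at this
        linarith
      have hbd : ∀ t ∈ Ioo (-|r|) |r|, ‖h t‖ ≤ C * T := by
        intro t ht
        have h1 := hb h |r| h0 (fun u hu => by
          have := hd u ⟨by linarith [hu.1], by linarith [hu.2]⟩
          rwa [Function.comp_apply, clip_of_norm_le (hin u hu).le] at this) t ht
        refine h1.trans (mul_le_mul_of_nonneg_left ?_ hC)
        exact ((abs_lt.2 ht).le.trans hrs).trans hsT.le
      have hr0 : |r| ≠ 0 := by
        intro hr
        rw [abs_eq_zero] at hr
        rw [hr, mem_preimage, h0, norm_zero, mem_Ici] at hrB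
        have : 0 < B := by positivity
        linarith
      have hrcl : r ∈ closure (Ioo (-|r|) |r|) := by
        rw [closure_Ioo (by
          have := abs_pos.2 (abs_ne_zero.1 hr0)
          intro hEq
          linarith)]
        exact ⟨neg_abs_le r, le_abs_self r⟩
      have hfin : ‖h r‖ ≤ C * T := by
        have hca : ContinuousWithinAt (fun u => ‖h u‖) (Ioo (-|r|) |r|) r :=
          ((hd r (abs_lt.1 (hrs.trans_lt hsT))).continuousAt.norm).continuousWithinAt
        exact hca.closure_le hrcl continuousWithinAt_const hbd
      have : B ≤ ‖h r‖ := hrB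
      linarith
    intro t ht
    have := hd t ht
    rwa [Function.comp_apply, clip_of_norm_le (hlt t ht).le] at this
  -- Local curves on (-(n+1), n+1) are glued by using index ⌈|t|⌉₊ at time t; the extra 1 keeps t
  -- interior.
  choose H hH0 hHd using fun n : ℕ => hex (n + 1) (by positivity)
  have hagree : ∀ (n : ℕ) (t : ℝ), t ∈ Ioo (-(n + 1 : ℝ)) (n + 1) → H ⌈|t|⌉₊ t = H n t := by
    intro n t ht
    have h1 : |t| < ⌈|t|⌉₊ + 1 := (Nat.le_ceil _).trans_lt (lt_add_one _)
    have h2 : |t| < n + 1 := abs_lt.2 ht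
    exact huniq _ _ (min (⌈|t|⌉₊ + 1 : ℝ) (n + 1)) (hH0 _) (hH0 _)
      (fun u hu => hHd _ u (abs_lt.1 ((abs_lt.2 hu).trans_le (min_le_left _ _))))
      (fun u hu => hHd _ u (abs_lt.1 ((abs_lt.2 hu).trans_le (min_le_right _ _))))
      (abs_lt.1 (lt_min h1 h2))
  refine ⟨fun t => H ⌈|t|⌉₊ t, ⟨hH0 _, fun t => ?_⟩, fun g hg => ?_⟩
  · have ht : t ∈ Ioo (-((⌈|t|⌉₊ : ℝ) + 1)) (⌈|t|⌉₊ + 1) :=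
      abs_lt.1 ((Nat.le_ceil _).trans_lt (lt_add_one _))
    refine (hHd _ t ht).congr_of_eventuallyEq ?_
    filter_upwards [Ioo_mem_nhds ht.1 ht.2] with u hu
    exact hagree _ u hu
  · funext t
    have ht : t ∈ Ioo (-((⌈|t|⌉₊ : ℝ) + 1)) (⌈|t|⌉₊ + 1) :=
      abs_lt.1 ((Nat.le_ceil _).trans_lt (lt_add_one _))
    exact huniq _ _ _ hg.1 (hH0 _) (fun u _ => hg.2 u) (hHd _) ht

end ODE

end IPD

namespace IPD

open Matrix Finset

/-! ### Relative entropy sums with values in `EReal`. -/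

section ExtendedSums

variable {ι : Type*}

theorem coe_finset_sum (s : Finset ι) (f : ι → ℝ) :
    ((∑ i ∈ s, f i : ℝ) : EReal) = ∑ i ∈ s, (f i : EReal) := by
  classical
  induction s using Finset.induction_on with
  | empty => simp
  | insert a s ha ih => rw [sum_insert ha, sum_insert ha, EReal.coe_add, ih]

/-- Excluding ⊥ matters: in `EReal`, ⊤ + ⊥ = ⊥. -/
theorem sum_eq_top (s : Finset ι) {f : ι → EReal} (hf : ∀ i, f i ≠ ⊥) {i : ι} (hi : i ∈ s)
    (hi' : f i = ⊤) : ∑ j ∈ s, f j = ⊤ := by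
  classical
  rw [← Finset.add_sum_erase s f hi, hi']
  exact EReal.top_add_of_ne_bot
    (Finset.sum_induction f (· ≠ ⊥) (fun a b ha hb => EReal.add_ne_bot_iff.2 ⟨ha, hb⟩)
      EReal.zero_ne_bot fun j _ => hf j)

theorem sum_mul_logRatio [Fintype ι] {w p q : ι → ℝ} (h : ∀ i, q i = 0 → w i = 0) :
    ∑ i, (w i : EReal) * logRatio (p i) (q i)
      = ((∑ i, w i * Real.log (p i / q i) : ℝ) : EReal) := by
  rw [coe_finset_sum]
  refine Finset.sum_congr rfl fun i _ => ?_
  by_cases hq : q i = 0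
  · simp [h i hq]
  · rw [logRatio, if_neg hq, EReal.coe_mul]

theorem sum_mul_logRatio_eq_top [Fintype ι] {w p q : ι → ℝ} (hw : ∀ i, 0 ≤ w i) {i : ι}
    (hq : q i = 0) (hi : w i ≠ 0) : ∑ i, (w i : EReal) * logRatio (p i) (q i) = ⊤ := by
  refine sum_eq_top _ (fun j => ?_) (mem_univ i) ?_
  · rw [logRatio]
    split_ifs
    · rcases (hw j).eq_or_lt with h0 | h0
      · simp [← h0]
      · simp [EReal.coe_mul_top_of_pos h0]
    · rw [← EReal.coe_mul]
      exact EReal.coe_ne_bot _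
  · rw [logRatio, if_pos hq, EReal.coe_mul_top_of_pos ((hw i).lt_of_ne' hi)]

end ExtendedSums

/-! ### Pointwise relative entropy. -/

section Divergence

/-- The pointwise relative entropy `p log (p / q) - p + q`. -/
noncomputable def klTerm (p q : ℝ) : ℝ := p * Real.log (p / q) - p + q

@[simp] theorem klTerm_self (p : ℝ) : klTerm p p = 0 := by
  by_cases hp : p = 0 <;> simp [klTerm, hp]

/-- This is log t < t - 1 at t = q / p ≠ 1. The correction -p + q gives the sign term by term and
cancels when summed over two stochastic rows. -/
theorem klTerm_pos {p q : ℝ} (hp : 0 ≤ p) (hq : 0 ≤ q) (h : q = 0 → p = 0) (hne : p ≠ q) :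
    0 < klTerm p q := by
  rcases hp.eq_or_lt with rfl | hp
  · simpa [klTerm] using hq.lt_of_ne hne
  · have hq' : 0 < q := hq.lt_of_ne fun h0 => hp.ne' (h h0.symm)
    have h1 := Real.log_lt_sub_one_of_pos (div_pos hq' hp)
      (fun h1 => hne ((div_eq_one_iff_eq hp.ne').1 h1).symm)
    have h2 : Real.log (p / q) = -Real.log (q / p) := by rw [← Real.log_inv, inv_div]
    have h3 : p * (q / p) = q := mul_div_cancel₀ _ hp.ne'
    rw [klTerm, h2]
    nlinarith

theorem klTerm_nonneg {p q : ℝ} (hp : 0 ≤ p) (hq : 0 ≤ q) (h : q = 0 → p = 0) :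
    0 ≤ klTerm p q := by
  by_cases hne : p = q
  · rw [hne, klTerm_self]
  · exact (klTerm_pos hp hq h hne).le

end Divergence

/-! ### Twisted matrices, the Gibbs identity and the optimality equation. -/

section Design

variable {Xu Xn : Type*} [Fintype Xu] [Fintype Xn] {R₀ : Xu × Xn → Xu → ℝ} {Q₀ : Xu × Xn → Xn → ℝ}

/-- The log-normalizer `Λ` of the twisted transition matrix. -/
noncomputable def logPartition (R₀ : Xu × Xn → Xu → ℝ) (Q₀ : Xu × Xn → Xn → ℝ) (g : Xu × Xn → ℝ)
    (x : Xu × Xn) : ℝ :=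
  Real.log (∑ y, product R₀ Q₀ x y * Real.exp (average Q₀ g x y.1))

theorem designMatrix_apply (g : Xu × Xn → ℝ) (x y : Xu × Xn) :
    designMatrix R₀ Q₀ g x y
      = product R₀ Q₀ x y * Real.exp (average Q₀ g x y.1 - logPartition R₀ Q₀ g x) := rfl

theorem designMatrix_eq_zero (g : Xu × Xn → ℝ) {x y : Xu × Xn}
    (h : product R₀ Q₀ x y = 0) : designMatrix R₀ Q₀ g x y = 0 := by
  rw [designMatrix_apply, h, zero_mul]

theorem designMatrix_pos_iff (g : Xu × Xn → ℝ) (x y : Xu × Xn) :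
    0 < product R₀ Q₀ x y ↔ 0 < designMatrix R₀ Q₀ g x y := by
  rw [designMatrix_apply, mul_pos_iff_of_pos_right (Real.exp_pos _)]

theorem product_nonneg (hR₀ : ∀ x, R₀ x ∈ stdSimplex ℝ Xu)
    (hQ₀ : ∀ x, Q₀ x ∈ stdSimplex ℝ Xn) (x y : Xu × Xn) : 0 ≤ product R₀ Q₀ x y :=
  mul_nonneg ((hR₀ x).1 _) ((hQ₀ x).1 _)

omit [Fintype Xu] in
theorem average_le (hQ₀ : ∀ x, Q₀ x ∈ stdSimplex ℝ Xn) {g : Xu × Xn → ℝ} {M : ℝ}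
    (h : ∀ x, g x ≤ M) (x : Xu × Xn) (u : Xu) : average Q₀ g x u ≤ M := by
  calc average Q₀ g x u ≤ ∑ n, Q₀ x n * M :=
        Finset.sum_le_sum fun n _ => mul_le_mul_of_nonneg_left (h _) ((hQ₀ x).1 n)
    _ = M := by rw [← Finset.sum_mul, (hQ₀ x).2, one_mul]

variable [DecidableEq Xu] [DecidableEq Xn]

/-- Since the Q₀ factor is fixed, an admissible P sees g only through its Q₀-average; hence the
twist uses the average. -/
theorem admissible_mulVec (hQ₀ : ∀ x, Q₀ x ∈ stdSimplex ℝ Xn)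
    {P : Matrix (Xu × Xn) (Xu × Xn) ℝ} (hP : P ∈ admissible Q₀) (g : Xu × Xn → ℝ)
    (x : Xu × Xn) : (P *ᵥ g) x = ∑ y, P x y * average Q₀ g x y.1 := by
  obtain ⟨-, R, -, rfl⟩ := hP
  simp only [mulVec, dotProduct, product, of_apply, Fintype.sum_prod_type]
  refine Finset.sum_congr rfl fun u _ => ?_
  simp only [mul_assoc, ← Finset.mul_sum, ← Finset.sum_mul, (hQ₀ x).2, one_mul]
  rfl

variable (hR₀ : ∀ x, R₀ x ∈ stdSimplex ℝ Xu) (hQ₀ : ∀ x, Q₀ x ∈ stdSimplex ℝ Xn)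
include hR₀ hQ₀

theorem product_mem_rowStochastic : product R₀ Q₀ ∈ rowStochastic ℝ (Xu × Xn) := by
  refine mem_rowStochastic_iff_sum.2 ⟨product_nonneg hR₀ hQ₀, fun x => ?_⟩
  simp only [product, of_apply, Fintype.sum_prod_type, ← Finset.mul_sum, (hQ₀ x).2, mul_one,
    (hR₀ x).2]

theorem product_mem_admissible : product R₀ Q₀ ∈ admissible Q₀ :=
  ⟨product_mem_rowStochastic hR₀ hQ₀, R₀, fun x => (hR₀ x).2, rfl⟩

theorem partition_pos (g : Xu × Xn → ℝ) (x : Xu × Xn) :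
    0 < ∑ y, product R₀ Q₀ x y * Real.exp (average Q₀ g x y.1) := by
  have h1 := sum_row_of_mem_rowStochastic (product_mem_rowStochastic hR₀ hQ₀) x
  refine Finset.sum_pos' (fun y _ => mul_nonneg (product_nonneg hR₀ hQ₀ x y) (Real.exp_pos _).le)
    ?_
  by_contra! hc
  have : ∑ y, product R₀ Q₀ x y ≤ 0 := Finset.sum_nonpos fun y hy =>
    nonpos_of_mul_nonpos_left (hc y hy) (Real.exp_pos _)
  linarith

theorem designMatrix_eq_div (g : Xu × Xn → ℝ) (x y : Xu × Xn) :
    designMatrix R₀ Q₀ g x y = product R₀ Q₀ x y * Real.exp (average Q₀ g x y.1)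
      / ∑ z, product R₀ Q₀ x z * Real.exp (average Q₀ g x z.1) := by
  rw [designMatrix_apply, Real.exp_sub, logPartition, Real.exp_log (partition_pos hR₀ hQ₀ g x),
    mul_div_assoc]

omit [DecidableEq Xu] [DecidableEq Xn] in
theorem designMatrix_nonneg (g : Xu × Xn → ℝ) (x y : Xu × Xn) :
    0 ≤ designMatrix R₀ Q₀ g x y :=
  mul_nonneg (product_nonneg hR₀ hQ₀ x y) (Real.exp_pos _).le

theorem designMatrix_mem_rowStochastic (g : Xu × Xn → ℝ) :
    designMatrix R₀ Q₀ g ∈ rowStochastic ℝ (Xu × Xn) := by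
  refine mem_rowStochastic_iff_sum.2 ⟨designMatrix_nonneg hR₀ hQ₀ g, fun x => ?_⟩
  simp only [designMatrix_eq_div hR₀ hQ₀, ← Finset.sum_div]
  exact div_self (partition_pos hR₀ hQ₀ g x).ne'

theorem designMatrix_mem_admissible (g : Xu × Xn → ℝ) :
    designMatrix R₀ Q₀ g ∈ admissible Q₀ := by
  have heq : designMatrix R₀ Q₀ g = product
      (fun x u => R₀ x u * Real.exp (average Q₀ g x u - logPartition R₀ Q₀ g x)) Q₀ := by
    ext x y
    rw [designMatrix_apply]
    simp only [product, of_apply]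
    ring
  refine ⟨designMatrix_mem_rowStochastic hR₀ hQ₀ g, _, fun x => ?_, heq⟩
  have := sum_row_of_mem_rowStochastic (designMatrix_mem_rowStochastic hR₀ hQ₀ g) x
  rw [heq] at this
  simpa only [product, of_apply, Fintype.sum_prod_type, ← Finset.mul_sum, (hQ₀ x).2, mul_one]
    using this

/-- The Gibbs variational identity for one row of an admissible matrix. -/
theorem mulVec_sub_sum_log {P : Matrix (Xu × Xn) (Xu × Xn) ℝ} (hP : P ∈ admissible Q₀)
    (g : Xu × Xn → ℝ) {x : Xu × Xn} (hac : ∀ y, product R₀ Q₀ x y = 0 → P x y = 0) :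
    (P *ᵥ g) x - ∑ y, P x y * Real.log (P x y / product R₀ Q₀ x y)
      = logPartition R₀ Q₀ g x - ∑ y, klTerm (P x y) (designMatrix R₀ Q₀ g x y) := by
  have hterm : ∀ y, P x y * average Q₀ g x y.1 - P x y * Real.log (P x y / product R₀ Q₀ x y)
      = P x y * logPartition R₀ Q₀ g x
        - P x y * Real.log (P x y / designMatrix R₀ Q₀ g x y) := by
    intro y
    by_cases hp : P x y = 0
    · simp [hp]
    · have h0 : product R₀ Q₀ x y ≠ 0 := fun h => hp (hac y h)
      rw [designMatrix_apply, ← div_div, Real.log_div (div_ne_zero hp h0) (Real.exp_ne_zero _),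
        Real.log_exp]
      ring
  have h1 := sum_row_of_mem_rowStochastic hP.1 x
  have h2 := sum_row_of_mem_rowStochastic (designMatrix_mem_rowStochastic hR₀ hQ₀ g) x
  simp only [klTerm, sum_add_distrib, sum_sub_distrib, h1, h2]
  rw [admissible_mulVec hQ₀ hP, ← sum_sub_distrib, Finset.sum_congr rfl fun y _ => hterm y,
    sum_sub_distrib, ← Finset.sum_mul, h1]
  ring

theorem klTerm_designMatrix_nonneg {P : Matrix (Xu × Xn) (Xu × Xn) ℝ} (hP : P ∈ admissible Q₀)
    (g : Xu × Xn → ℝ) {x : Xu × Xn} (hac : ∀ y, product R₀ Q₀ x y = 0 → P x y = 0)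
    (y : Xu × Xn) : 0 ≤ klTerm (P x y) (designMatrix R₀ Q₀ g x y) := by
  refine klTerm_nonneg (nonneg_of_mem_rowStochastic hP.1) (designMatrix_nonneg hR₀ hQ₀ g x y)
    fun h => hac y ?_
  rw [designMatrix_apply] at h
  exact (mul_eq_zero.1 h).resolve_right (Real.exp_ne_zero _)

/-- The Gibbs identity at P = P₀, where the entropy vanishes (Jensen's inequality). -/
theorem product_mulVec_le_logPartition (g : Xu × Xn → ℝ) (x : Xu × Xn) :
    (product R₀ Q₀ *ᵥ g) x ≤ logPartition R₀ Q₀ g x := by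
  have hP := product_mem_admissible hR₀ hQ₀
  have h1 := mulVec_sub_sum_log hR₀ hQ₀ hP g (x := x) fun _ h => h
  have h2 : ∑ y, product R₀ Q₀ x y * Real.log (product R₀ Q₀ x y / product R₀ Q₀ x y) = 0 :=
    Finset.sum_eq_zero fun y _ => by
      by_cases h : product R₀ Q₀ x y = 0 <;> simp [h]
  have h3 : 0 ≤ ∑ y, klTerm (product R₀ Q₀ x y) (designMatrix R₀ Q₀ g x y) :=
    Finset.sum_nonneg fun y _ => klTerm_designMatrix_nonneg hR₀ hQ₀ hP g (fun _ h => h) y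
  linarith

theorem logPartition_le {g : Xu × Xn → ℝ} {M : ℝ} (h : ∀ x, g x ≤ M) (x : Xu × Xn) :
    logPartition R₀ Q₀ g x ≤ M := by
  rw [logPartition, Real.log_le_iff_le_exp (partition_pos hR₀ hQ₀ g x)]
  calc _ ≤ ∑ y, product R₀ Q₀ x y * Real.exp M := Finset.sum_le_sum fun y _ =>
        mul_le_mul_of_nonneg_left (Real.exp_le_exp.2 (average_le hQ₀ h x _))
          (product_nonneg hR₀ hQ₀ x y)
    _ = Real.exp M := by
      rw [← Finset.sum_mul, sum_row_of_mem_rowStochastic (product_mem_rowStochastic hR₀ hQ₀),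
        one_mul]

/-- Convexity of Λ, with the row of the twisted matrix as gradient: Gibbs is an equality at f and an
inequality at g. -/
theorem designMatrix_mulVec_sub_le (f g : Xu × Xn → ℝ) (x : Xu × Xn) :
    (designMatrix R₀ Q₀ f *ᵥ (g - f)) x ≤ logPartition R₀ Q₀ g x - logPartition R₀ Q₀ f x := by
  have hP := designMatrix_mem_admissible hR₀ hQ₀ f
  have hac : ∀ y, product R₀ Q₀ x y = 0 → designMatrix R₀ Q₀ f x y = 0 := fun y =>
    designMatrix_eq_zero f
  have h1 := mulVec_sub_sum_log hR₀ hQ₀ hP g hac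
  have h2 := mulVec_sub_sum_log hR₀ hQ₀ hP f hac
  have h3 : 0 ≤ ∑ y, klTerm (designMatrix R₀ Q₀ f x y) (designMatrix R₀ Q₀ g x y) :=
    Finset.sum_nonneg fun y _ => klTerm_designMatrix_nonneg hR₀ hQ₀ hP g hac y
  simp only [klTerm_self, sum_const_zero] at h2
  rw [mulVec_sub, Pi.sub_apply]
  linarith

/-- The optimality equation in its log-sum-exp form. -/
theorem solvesAROE_iff {U : Xu × Xn → ℝ} {ζ : ℝ} {g : Xu × Xn → ℝ} {η : ℝ} :
    SolvesAROE R₀ Q₀ U ζ g η ↔ ∀ x, ζ * U x + logPartition R₀ Q₀ g x = g x + η := by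
  have hval : ∀ (x : Xu × Xn) {P : Matrix (Xu × Xn) (Xu × Xn) ℝ}, P ∈ admissible Q₀ →
      (∀ y, product R₀ Q₀ x y = 0 → P x y = 0) →
      oneStepReward (product R₀ Q₀) U ζ x P + ((∑ y, P x y * g y : ℝ) : EReal)
        = ((ζ * U x + logPartition R₀ Q₀ g x
            - ∑ y, klTerm (P x y) (designMatrix R₀ Q₀ g x y) : ℝ) : EReal) := by
    intro x P hP hac
    rw [oneStepReward, sum_mul_logRatio hac, ← EReal.coe_sub, ← EReal.coe_add, EReal.coe_eq_coe_iff]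
    have := mulVec_sub_sum_log hR₀ hQ₀ hP g hac
    rw [mulVec, dotProduct] at this
    linarith
  refine forall_congr' fun x => ?_
  have hgr : IsGreatest ((fun P : Matrix (Xu × Xn) (Xu × Xn) ℝ =>
      oneStepReward (product R₀ Q₀) U ζ x P + ((∑ y, P x y * g y : ℝ) : EReal)) ''
        admissible Q₀) ((ζ * U x + logPartition R₀ Q₀ g x : ℝ) : EReal) := by
    constructor
    · refine ⟨designMatrix R₀ Q₀ g, designMatrix_mem_admissible hR₀ hQ₀ g, ?_⟩
      beta_reduce
      rw [hval x (designMatrix_mem_admissible hR₀ hQ₀ g) fun y => designMatrix_eq_zero g]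
      simp
    · rintro _ ⟨P, hP, rfl⟩
      beta_reduce
      by_cases hac : ∀ y, product R₀ Q₀ x y = 0 → P x y = 0
      · rw [hval x hP hac, EReal.coe_le_coe_iff]
        have : 0 ≤ ∑ y, klTerm (P x y) (designMatrix R₀ Q₀ g x y) :=
          Finset.sum_nonneg fun y _ => klTerm_designMatrix_nonneg hR₀ hQ₀ hP g hac y
        linarith
      -- Charging a transition forbidden by P₀ costs ⊤, so the value is ⊥.
      · push Not at hac
        obtain ⟨y, hy, hy'⟩ := hac
        have htop := sum_mul_logRatio_eq_top (w := fun y => P x y) (p := fun y => P x y)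
          (q := fun y => product R₀ Q₀ x y) (fun y => nonneg_of_mem_rowStochastic hP.1) hy hy'
        rw [oneStepReward, htop, EReal.sub_top, EReal.bot_add]
        exact bot_le
  exact ⟨fun h => EReal.coe_injective (hgr.unique h), fun h => h ▸ hgr⟩

/-- Subtracting the equations gives Λ_g - Λ_f = g - f, so by convexity g - f is superharmonic, hence
constant. -/
theorem aroe_unique (hirr : (product R₀ Q₀).IsIrreducible) {U : Xu × Xn → ℝ} {ζ η : ℝ}
    {f g : Xu × Xn → ℝ} (hf : ∀ x, ζ * U x + logPartition R₀ Q₀ f x = f x + η)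
    (hg : ∀ x, ζ * U x + logPartition R₀ Q₀ g x = g x + η) {x₀ : Xu × Xn} (h0 : g x₀ = f x₀) :
    g = f := by
  funext x
  have := eq_of_superharmonic (designMatrix_mem_rowStochastic hR₀ hQ₀ f)
    ((isIrreducible_congr (product_nonneg hR₀ hQ₀) (designMatrix_nonneg hR₀ hQ₀ f)
      (designMatrix_pos_iff f)).1 hirr) (f := g - f) (fun y => by
        have := designMatrix_mulVec_sub_le hR₀ hQ₀ f g y
        rw [Pi.sub_apply]
        linarith [hf y, hg y]) x x₀
  simp only [Pi.sub_apply] at this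
  linarith

/-- Solutions of the optimality equation grow at most linearly in the parameter. -/
theorem exists_norm_le_of_aroe (hirr : (product R₀ Q₀).IsIrreducible) (U : Xu × Xn → ℝ)
    (x₀ : Xu × Xn) : ∃ C, 0 ≤ C ∧ ∀ (ζ η : ℝ) (g : Xu × Xn → ℝ),
      (∀ x, ζ * U x + logPartition R₀ Q₀ g x = g x + η) → g x₀ = 0 → ‖g‖ ≤ C * |ζ| := by
  have hP := product_mem_rowStochastic hR₀ hQ₀
  choose k hk using (isIrreducible_iff_exists_pow_pos hirr.nonneg).1 hirr
  -- Summing over all pairs gives one constant dominating every ratio k / P₀^k(y, z).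
  set D : ℝ := ∑ y, ∑ z, k y z / (product R₀ Q₀ ^ k y z) y z with hD
  have hDterm : ∀ y z, 0 ≤ (k y z : ℝ) / (product R₀ Q₀ ^ k y z) y z := fun y z =>
    div_nonneg (Nat.cast_nonneg _) (hk y z).2.le
  have hDle : ∀ y z, (k y z : ℝ) / (product R₀ Q₀ ^ k y z) y z ≤ D := fun y z =>
    (Finset.single_le_sum (fun z _ => hDterm y z) (mem_univ z)).trans
      (Finset.single_le_sum (f := fun y => ∑ z, (k y z : ℝ) / (product R₀ Q₀ ^ k y z) y z)
        (fun y _ => Finset.sum_nonneg fun z _ => hDterm y z) (mem_univ y))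
  have hD0 : 0 ≤ D := (hDterm x₀ x₀).trans (hDle x₀ x₀)
  refine ⟨2 * ‖U‖ * D, by positivity, fun ζ η g hg h0 => ?_⟩
  have : Nonempty (Xu × Xn) := ⟨x₀⟩
  have hU : ∀ x, |ζ * U x| ≤ |ζ| * ‖U‖ := fun x => by
    rw [abs_mul]
    exact mul_le_mul_of_nonneg_left (norm_le_pi_norm U x) (abs_nonneg _)
  obtain ⟨m, hm⟩ := Finite.exists_min g
  obtain ⟨M, hM⟩ := Finite.exists_max g
  -- At a maximizer M of g, Λ_g(M) ≤ g(M), so the equation leaves η ≤ ζ U(M).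
  have hη : η ≤ |ζ| * ‖U‖ := by
    have := logPartition_le hR₀ hQ₀ hM M
    linarith [hg M, (abs_le.1 (hU M)).2]
  have hsuper : ∀ x, (product R₀ Q₀ *ᵥ g) x - 2 * (|ζ| * ‖U‖) ≤ g x := fun x => by
    linarith [hg x, product_mulVec_le_logPartition hR₀ hQ₀ g x, (abs_le.1 (hU x)).1]
  have hspan : ∀ z, g z - g m ≤ 2 * ‖U‖ * D * |ζ| := by
    intro z
    have h1 := pow_apply_mul_sub_le hP hsuper hm (k m z) z
    have h2 : g z - g m ≤ (k m z) / (product R₀ Q₀ ^ k m z) m z * (2 * (|ζ| * ‖U‖)) := by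
      rw [div_mul_eq_mul_div, le_div_iff₀ (hk m z).2]
      linarith
    calc g z - g m ≤ _ := h2
      _ ≤ D * (2 * (|ζ| * ‖U‖)) := mul_le_mul_of_nonneg_right (hDle m z) (by positivity)
      _ = 2 * ‖U‖ * D * |ζ| := by ring
  rw [pi_norm_le_iff_of_nonneg (by positivity)]
  intro z
  rw [Real.norm_eq_abs, abs_le]
  -- As g x₀ = 0 lies between the extremes of g, the oscillation bounds the norm.
  have h1 := hspan x₀
  have h2 := hspan z
  have h3 := hm x₀
  have h4 := hm z
  constructor <;> linarith

theorem hasDerivAt_logPartition {h : ℝ → Xu × Xn → ℝ} {h' : Xu × Xn → ℝ} {ζ : ℝ}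
    (hh : HasDerivAt h h' ζ) (x : Xu × Xn) :
    HasDerivAt (fun s => logPartition R₀ Q₀ (h s) x) ((designMatrix R₀ Q₀ (h ζ) *ᵥ h') x) ζ := by
  have havg : ∀ u, HasDerivAt (fun s => average Q₀ (h s) x u) (average Q₀ h' x u) ζ := fun u =>
    HasDerivAt.fun_sum fun n _ => ((hasDerivAt_pi.1 hh) (u, n)).const_mul _
  have hS : HasDerivAt (fun s => ∑ y, product R₀ Q₀ x y * Real.exp (average Q₀ (h s) x y.1))
      (∑ y, product R₀ Q₀ x y * (Real.exp (average Q₀ (h ζ) x y.1) * average Q₀ h' x y.1)) ζ :=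
    HasDerivAt.fun_sum fun y _ => ((havg y.1).exp).const_mul _
  have hlog := hS.log (partition_pos hR₀ hQ₀ (h ζ) x).ne'
  refine hlog.congr_deriv (Eq.symm ?_)
  rw [admissible_mulVec hQ₀ (designMatrix_mem_admissible hR₀ hQ₀ _), Finset.sum_div]
  refine Finset.sum_congr rfl fun y _ => ?_
  rw [designMatrix_eq_div hR₀ hQ₀]
  ring

theorem contDiff_designMatrix_apply (x y : Xu × Xn) :
    ContDiff ℝ 1 fun g : Xu × Xn → ℝ => designMatrix R₀ Q₀ g x y := by
  have havg : ∀ u, ContDiff ℝ 1 fun g : Xu × Xn → ℝ => average Q₀ g x u := fun u =>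
    ContDiff.sum fun n _ => contDiff_const.mul (contDiff_apply ℝ ℝ (u, n))
  have hS : ContDiff ℝ 1 fun g : Xu × Xn → ℝ =>
      ∑ y, product R₀ Q₀ x y * Real.exp (average Q₀ g x y.1) :=
    ContDiff.sum fun y _ => contDiff_const.mul (havg y.1).exp
  simp only [designMatrix_eq_div hR₀ hQ₀]
  exact (contDiff_const.mul (havg y.1).exp).div hS fun g => (partition_pos hR₀ hQ₀ g x).ne'

omit [Fintype Xu] [Fintype Xn] [DecidableEq Xu] [DecidableEq Xn] hR₀ hQ₀ in
theorem contDiff_det {E X : Type*} [NormedAddCommGroup E] [NormedSpace ℝ E] [Fintype X]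
    [DecidableEq X] {A : E → Matrix X X ℝ} {n : WithTop ℕ∞}
    (hA : ∀ i j, ContDiff ℝ n fun e => A e i j) : ContDiff ℝ n fun e => (A e).det := by
  simp only [det_apply]
  exact ContDiff.sum fun σ _ => (contDiff_prod fun i _ => hA _ _).const_smul _

omit [Fintype Xu] [Fintype Xn] [DecidableEq Xu] [DecidableEq Xn] hR₀ hQ₀ in
-- Cramer's rule: each coordinate is a quotient of determinants.
theorem contDiff_inv_mulVec {E X : Type*} [NormedAddCommGroup E] [NormedSpace ℝ E] [Fintype X]
    [DecidableEq X] {A : E → Matrix X X ℝ} {n : WithTop ℕ∞}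
    (hA : ∀ i j, ContDiff ℝ n fun e => A e i j) (hu : ∀ e, IsUnit (A e)) (b : X → ℝ) (i : X) :
    ContDiff ℝ n fun e => ((A e)⁻¹ *ᵥ b) i := by
  have heq : ∀ e, ((A e)⁻¹ *ᵥ b) i = ((A e).det)⁻¹ * ((A e).updateCol i b).det := by
    intro e
    rw [Matrix.inv_def, smul_mulVec, ← cramer_eq_adjugate_mulVec, Pi.smul_apply, cramer_apply,
      Ring.inverse_eq_inv', smul_eq_mul]
  simp only [heq]
  refine ((contDiff_det hA).inv fun e => ?_).mul (contDiff_det fun j k => ?_)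
  · exact ((isUnit_iff_isUnit_det _).1 (hu e)).ne_zero
  · simp only [updateCol_apply]
    split_ifs
    · exact contDiff_const
    · exact hA j k

theorem contDiff_pinned_inv (hirr : (product R₀ Q₀).IsIrreducible) (U : Xu × Xn → ℝ)
    (x₀ x : Xu × Xn) : ContDiff ℝ 1 fun g : Xu × Xn → ℝ =>
      ((pinned x₀ (designMatrix R₀ Q₀ g))⁻¹ *ᵥ U) x := by
  refine contDiff_inv_mulVec (fun i j => ?_) (fun g =>
    isUnit_pinned (designMatrix_mem_rowStochastic hR₀ hQ₀ g)
    ((isIrreducible_congr (product_nonneg hR₀ hQ₀) (designMatrix_nonneg hR₀ hQ₀ g)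
      (designMatrix_pos_iff g)).1 hirr) x₀) U x
  simp only [pinned, Matrix.add_apply, Matrix.sub_apply]
  exact (contDiff_const.sub (contDiff_designMatrix_apply hR₀ hQ₀ i j)).add contDiff_const

end Design

end IPD

namespace IPD

open Matrix Finset

/-! ### The ergodic control problem and its unique maximizer. -/

section Objective

variable {Xu Xn : Type*} [Fintype Xu] [Fintype Xn]

theorem relEntropyRate_eq_coe {X : Type*} [Fintype X] {π : X → ℝ} {P P₀ : Matrix X X ℝ}
    (hac : ∀ x y, P₀ x y = 0 → π x * P x y = 0) :
    relEntropyRate π P P₀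
      = ((∑ x, ∑ y, π x * P x y * Real.log (P x y / P₀ x y) : ℝ) : EReal) := by
  have := sum_mul_logRatio (w := fun z : X × X => π z.1 * P z.1 z.2) (p := fun z => P z.1 z.2)
    (q := fun z => P₀ z.1 z.2) fun z => hac z.1 z.2
  simpa only [relEntropyRate, Fintype.sum_prod_type] using this

theorem relEntropyRate_eq_top {X : Type*} [Fintype X] {π : X → ℝ} {P P₀ : Matrix X X ℝ}
    (hπ : ∀ x, 0 ≤ π x) (hP : ∀ x y, 0 ≤ P x y) {x y : X} (h0 : P₀ x y = 0)
    (h : π x * P x y ≠ 0) : relEntropyRate π P P₀ = ⊤ := by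
  have := sum_mul_logRatio_eq_top (w := fun z : X × X => π z.1 * P z.1 z.2)
    (p := fun z => P z.1 z.2) (q := fun z => P₀ z.1 z.2) (fun z => mul_nonneg (hπ _) (hP _ _))
    (i := (x, y)) h0 h
  simpa only [relEntropyRate, Fintype.sum_prod_type] using this

variable [DecidableEq Xu] [DecidableEq Xn]
  {R₀ : Xu × Xn → Xu → ℝ} {Q₀ : Xu × Xn → Xn → ℝ}
  (hR₀ : ∀ x, R₀ x ∈ stdSimplex ℝ Xu) (hQ₀ : ∀ x, Q₀ x ∈ stdSimplex ℝ Xn)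
  {U : Xu × Xn → ℝ} {ζ η : ℝ} {g π : Xu × Xn → ℝ} {P : Matrix (Xu × Xn) (Xu × Xn) ℝ}
include hR₀ hQ₀

/-- Integrate the Gibbs identity against π: invariance cancels g - Pg. Rows with π x = 0 drop out,
so absolute continuity is needed only on the support of π. -/
theorem objective_eq (hg : ∀ x, ζ * U x + logPartition R₀ Q₀ g x = g x + η)
    (hf : (π, P) ∈ feasible Q₀) (hac : ∀ x y, product R₀ Q₀ x y = 0 → π x * P x y = 0) :
    objective (product R₀ Q₀) U ζ (π, P)
      = ((η - ∑ x, π x * ∑ y, klTerm (P x y) (designMatrix R₀ Q₀ g x y) : ℝ) : EReal) := by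
  obtain ⟨hP, hπ⟩ := hf
  simp only at hP hπ
  rw [objective, relEntropyRate_eq_coe hac, ← EReal.coe_sub, EReal.coe_eq_coe_iff]
  have hrow : ∀ x, π x * (ζ * U x - ∑ y, P x y * Real.log (P x y / product R₀ Q₀ x y))
      = π x * (g x + η - (P *ᵥ g) x - ∑ y, klTerm (P x y) (designMatrix R₀ Q₀ g x y)) := by
    intro x
    by_cases h0 : π x = 0
    · simp [h0]
    · have := mulVec_sub_sum_log hR₀ hQ₀ hP g
        fun y hy => (mul_eq_zero.1 (hac x y hy)).resolve_left h0
      rw [← hg x, add_sub_assoc, add_sub_assoc]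
      congr 1
      linarith
  have hsum := Finset.sum_congr rfl fun x (_ : x ∈ univ) => hrow x
  simp only [mul_sub, mul_add, sum_sub_distrib, sum_add_distrib, ← Finset.sum_mul, hπ.1.2,
    sum_mul_mulVec hπ.2, one_mul] at hsum
  have h1 : ∑ x, π x * (ζ * U x) = ζ * ∑ x, π x * U x := by
    rw [Finset.mul_sum]
    exact Finset.sum_congr rfl fun x _ => by ring
  have h2 : ∑ x, ∑ y, π x * P x y * Real.log (P x y / product R₀ Q₀ x y)
      = ∑ x, π x * ∑ y, P x y * Real.log (P x y / product R₀ Q₀ x y) := by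
    simp only [Finset.mul_sum, mul_assoc]
  rw [h1] at hsum
  rw [h2, hsum]
  ring

theorem mul_sum_klTerm_nonneg (hf : (π, P) ∈ feasible Q₀)
    (hac : ∀ x y, product R₀ Q₀ x y = 0 → π x * P x y = 0) (x : Xu × Xn) :
    0 ≤ π x * ∑ y, klTerm (P x y) (designMatrix R₀ Q₀ g x y) := by
  by_cases h0 : π x = 0
  · simp [h0]
  · exact mul_nonneg (hf.2.1.1 x) (Finset.sum_nonneg fun y _ =>
      klTerm_designMatrix_nonneg hR₀ hQ₀ hf.1 g
        (fun y hy => (mul_eq_zero.1 (hac x y hy)).resolve_left h0) y)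

omit hR₀ hQ₀ in
theorem objective_eq_bot (hf : (π, P) ∈ feasible Q₀)
    (hac : ¬ ∀ x y, product R₀ Q₀ x y = 0 → π x * P x y = 0) :
    objective (product R₀ Q₀) U ζ (π, P) = ⊥ := by
  push Not at hac
  obtain ⟨x, y, h0, h⟩ := hac
  have htop := relEntropyRate_eq_top (P := P) hf.2.1.1
    (fun x y => nonneg_of_mem_rowStochastic hf.1.1) h0 h
  rw [objective, htop, EReal.sub_top]

theorem objective_le (hg : ∀ x, ζ * U x + logPartition R₀ Q₀ g x = g x + η)
    (hf : (π, P) ∈ feasible Q₀) : objective (product R₀ Q₀) U ζ (π, P) ≤ (η : EReal) := by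
  by_cases hac : ∀ x y, product R₀ Q₀ x y = 0 → π x * P x y = 0
  · rw [objective_eq hR₀ hQ₀ hg hf hac, EReal.coe_le_coe_iff]
    have := Finset.sum_nonneg fun x (_ : x ∈ univ) =>
      mul_sum_klTerm_nonneg hR₀ hQ₀ (g := g) hf hac x
    linarith
  · rw [objective_eq_bot hf hac]
    exact bot_le

/-- Zero divergence identifies only the rows charged by π. But then π is invariant for the
irreducible twisted matrix as well, hence positive everywhere, and no row is missed. -/
theorem eq_designMatrix_of_objective_eq (hirr : (product R₀ Q₀).IsIrreducible)
    (hg : ∀ x, ζ * U x + logPartition R₀ Q₀ g x = g x + η)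
    (hf : (π, P) ∈ feasible Q₀) (heq : objective (product R₀ Q₀) U ζ (π, P) = (η : EReal)) :
    P = designMatrix R₀ Q₀ g := by
  by_cases hac : ∀ x y, product R₀ Q₀ x y = 0 → π x * P x y = 0
  swap
  · rw [objective_eq_bot hf hac] at heq
    exact absurd heq (EReal.bot_ne_coe η)
  rw [objective_eq hR₀ hQ₀ hg hf hac, EReal.coe_eq_coe_iff, sub_eq_self,
    Finset.sum_eq_zero_iff_of_nonneg fun x _ => mul_sum_klTerm_nonneg hR₀ hQ₀ hf hac x] at heq
  have hrow : ∀ x, π x ≠ 0 → ∀ y, P x y = designMatrix R₀ Q₀ g x y := by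
    intro x hx y
    have hacx : ∀ y, product R₀ Q₀ x y = 0 → P x y = 0 := fun y hy =>
      (mul_eq_zero.1 (hac x y hy)).resolve_left hx
    have h1 := (mul_eq_zero.1 (heq x (mem_univ x))).resolve_left hx
    rw [Finset.sum_eq_zero_iff_of_nonneg fun y _ =>
      klTerm_designMatrix_nonneg hR₀ hQ₀ hf.1 g hacx y] at h1
    by_contra hne
    refine (klTerm_pos (nonneg_of_mem_rowStochastic hf.1.1) (designMatrix_nonneg hR₀ hQ₀ g x y)
      (fun h => hacx y ?_) hne).ne' (h1 y (mem_univ y))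
    rw [designMatrix_apply] at h
    exact (mul_eq_zero.1 h).resolve_right (Real.exp_ne_zero _)
  have hinv : IsInvariantPmf (designMatrix R₀ Q₀ g) π := by
    refine ⟨hf.2.1, ?_⟩
    refine Eq.trans ?_ hf.2.2
    funext y
    refine Finset.sum_congr rfl fun x _ => ?_
    change π x * designMatrix R₀ Q₀ g x y = π x * P x y
    by_cases hx : π x = 0
    · simp [hx]
    · rw [hrow x hx y]
  have hpos := hinv.pos ((isIrreducible_congr (product_nonneg hR₀ hQ₀)
    (designMatrix_nonneg hR₀ hQ₀ g) (designMatrix_pos_iff g)).1 hirr)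
  ext x y
  exact hrow x (hpos x).ne' y

theorem invPmf_designMatrix_feasible [Nonempty (Xu × Xn)] (g : Xu × Xn → ℝ) :
    (invPmf (designMatrix R₀ Q₀ g), designMatrix R₀ Q₀ g) ∈ feasible Q₀ :=
  ⟨designMatrix_mem_admissible hR₀ hQ₀ g,
    isInvariantPmf_invPmf (designMatrix_mem_rowStochastic hR₀ hQ₀ g)⟩

theorem objective_designMatrix [Nonempty (Xu × Xn)]
    (hg : ∀ x, ζ * U x + logPartition R₀ Q₀ g x = g x + η) :
    objective (product R₀ Q₀) U ζ (invPmf (designMatrix R₀ Q₀ g), designMatrix R₀ Q₀ g)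
      = (η : EReal) := by
  rw [objective_eq hR₀ hQ₀ hg (invPmf_designMatrix_feasible hR₀ hQ₀ g)
    fun x y h => by rw [designMatrix_eq_zero g h, mul_zero]]
  simp

theorem isGreatest_objective [Nonempty (Xu × Xn)]
    (hg : ∀ x, ζ * U x + logPartition R₀ Q₀ g x = g x + η) :
    IsGreatest (objective (product R₀ Q₀) U ζ '' feasible Q₀) (η : EReal) := by
  refine ⟨⟨_, invPmf_designMatrix_feasible hR₀ hQ₀ g, objective_designMatrix hR₀ hQ₀ hg⟩, ?_⟩
  rintro _ ⟨⟨π, P⟩, hf, rfl⟩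
  exact objective_le hR₀ hQ₀ hg hf

theorem optimalReward_eq [Nonempty (Xu × Xn)]
    (hg : ∀ x, ζ * U x + logPartition R₀ Q₀ g x = g x + η) :
    optimalReward R₀ Q₀ U ζ = η := by
  rw [optimalReward, (isGreatest_objective hR₀ hQ₀ hg).isLUB.sSup_eq, EReal.toReal_coe]

theorem optimalMatrices_eq [Nonempty (Xu × Xn)] (hirr : (product R₀ Q₀).IsIrreducible)
    (hg : ∀ x, ζ * U x + logPartition R₀ Q₀ g x = g x + η) :
    optimalMatrices R₀ Q₀ U ζ = {designMatrix R₀ Q₀ g} := by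
  ext P
  rw [Set.mem_singleton_iff]
  constructor
  · rintro ⟨π, hf, hmax⟩
    refine eq_designMatrix_of_objective_eq hR₀ hQ₀ hirr hg hf
      (le_antisymm (objective_le hR₀ hQ₀ hg hf) ?_)
    rw [← objective_designMatrix hR₀ hQ₀ hg]
    exact hmax (invPmf_designMatrix_feasible hR₀ hQ₀ g)
  · rintro rfl
    refine ⟨_, invPmf_designMatrix_feasible hR₀ hQ₀ g, fun p hp => ?_⟩
    change objective _ U ζ p ≤ objective _ U ζ (_, _)
    rw [objective_designMatrix hR₀ hQ₀ hg]
    exact objective_le hR₀ hQ₀ hg hp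

/-- The steady-state mean is a subgradient of the optimal reward. -/
theorem add_mul_steadyMean_le [Nonempty (Xu × Xn)] {ζ' η' : ℝ} {g' : Xu × Xn → ℝ}
    (hg : ∀ x, ζ * U x + logPartition R₀ Q₀ g x = g x + η)
    (hg' : ∀ x, ζ' * U x + logPartition R₀ Q₀ g' x = g' x + η') :
    η + (ζ' - ζ) * steadyMean U (designMatrix R₀ Q₀ g) ≤ η' := by
  have hac : ∀ x y, product R₀ Q₀ x y = 0 →
      invPmf (designMatrix R₀ Q₀ g) x * designMatrix R₀ Q₀ g x y = 0 := fun x y h => by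
    rw [designMatrix_eq_zero g h, mul_zero]
  -- One feasible pair is evaluated at both parameters, so the entropy rate cancels.
  have h1 := objective_designMatrix hR₀ hQ₀ hg
  have h2 := objective_le hR₀ hQ₀ hg' (invPmf_designMatrix_feasible hR₀ hQ₀ g)
  rw [objective, relEntropyRate_eq_coe hac, ← EReal.coe_sub, EReal.coe_eq_coe_iff] at h1
  rw [objective, relEntropyRate_eq_coe hac, ← EReal.coe_sub, EReal.coe_le_coe_iff] at h2
  simp only at h1 h2
  rw [steadyMean]
  linarith

end Objective

/-! ### Integral curves of the design. -/

section Trajectory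

variable {Xu Xn : Type*} [Fintype Xu] [Fintype Xn] [DecidableEq Xu] [DecidableEq Xn]
  {R₀ : Xu × Xn → Xu → ℝ} {Q₀ : Xu × Xn → Xn → ℝ}

theorem eq_apply_zero_of_hasDerivAt_zero {f : ℝ → ℝ} {T : ℝ}
    (hf : ∀ t ∈ Set.Ioo (-T) T, HasDerivAt f 0 t) {t : ℝ} (ht : t ∈ Set.Ioo (-T) T) :
    f t = f 0 := by
  have h0 : (0 : ℝ) ∈ Set.Ioo (-T) T := ⟨by linarith [ht.1, ht.2], by linarith [ht.1, ht.2]⟩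
  have := (convex_Ioo (-T) T).norm_image_sub_le_of_norm_hasDerivWithin_le (C := 0)
    (fun s hs => (hf s hs).hasDerivWithinAt) (fun _ _ => by simp) h0 ht
  rw [zero_mul, norm_le_zero_iff, sub_eq_zero] at this
  exact this

variable (hR₀ : ∀ x, R₀ x ∈ stdSimplex ℝ Xu) (hQ₀ : ∀ x, Q₀ x ∈ stdSimplex ℝ Xn)
  (hirr : (product R₀ Q₀).IsIrreducible) {U : Xu × Xn → ℝ} {x₀ : Xu × Xn}
include hR₀ hQ₀ hirr

theorem designMatrix_isIrreducible (g : Xu × Xn → ℝ) : (designMatrix R₀ Q₀ g).IsIrreducible :=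
  (isIrreducible_congr (product_nonneg hR₀ hQ₀) (designMatrix_nonneg hR₀ hQ₀ g)
    (designMatrix_pos_iff g)).1 hirr

/-- The derivative is U + PH° - H°, which Poisson's equation turns into a value independent of x. -/
theorem hasDerivAt_reward {h : ℝ → Xu × Xn → ℝ} {ζ : ℝ}
    (hh : HasDerivAt h (ipdMap U x₀ (designMatrix R₀ Q₀ (h ζ))) ζ) (x : Xu × Xn) :
    HasDerivAt (fun s => s * U x + logPartition R₀ Q₀ (h s) x - h s x)
      (steadyMean U (designMatrix R₀ Q₀ (h ζ))) ζ := by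
  have h1 := (((hasDerivAt_id ζ).mul_const (U x)).add
    (hasDerivAt_logPartition hR₀ hQ₀ hh x)).sub ((hasDerivAt_pi.1 hh) x)
  have h2 := ((poisson_iff_eq_ipdMap (designMatrix_mem_rowStochastic hR₀ hQ₀ (h ζ))
    (designMatrix_isIrreducible hR₀ hQ₀ hirr (h ζ)) U x₀ _).2 rfl).2 x
  refine h1.congr_deriv ?_
  rw [h2]
  ring

/-- Integral curves of the design solve the optimality equation. -/
theorem aroe_of_integralCurve {h : ℝ → Xu × Xn → ℝ} {T : ℝ} (h0 : h 0 = 0)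
    (hh : ∀ t ∈ Set.Ioo (-T) T, HasDerivAt h (ipdMap U x₀ (designMatrix R₀ Q₀ (h t))) t)
    {t : ℝ} (ht : t ∈ Set.Ioo (-T) T) :
    h t x₀ = 0 ∧ ∀ x, t * U x + logPartition R₀ Q₀ (h t) x
      = h t x + (t * U x₀ + logPartition R₀ Q₀ (h t) x₀ - h t x₀) := by
  have hlog : ∀ x, logPartition R₀ Q₀ (h 0) x = 0 := fun x => by
    rw [h0, logPartition]
    simp [average, sum_row_of_mem_rowStochastic (product_mem_rowStochastic hR₀ hQ₀)]
  constructor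
  · have := eq_apply_zero_of_hasDerivAt_zero (f := fun s => h s x₀) (fun s hs => by
      simpa [ipdMap] using (hasDerivAt_pi.1 (hh s hs)) x₀) ht
    simpa [h0] using this
  · intro x
    -- The rewards at x and x₀ have equal derivatives and both start from 0.
    have := eq_apply_zero_of_hasDerivAt_zero
      (f := fun s => (s * U x + logPartition R₀ Q₀ (h s) x - h s x)
        - (s * U x₀ + logPartition R₀ Q₀ (h s) x₀ - h s x₀)) (fun s hs =>
      ((hasDerivAt_reward hR₀ hQ₀ hirr (hh s hs) x).fun_sub
        (hasDerivAt_reward hR₀ hQ₀ hirr (hh s hs) x₀)).congr_deriv (sub_self _)) ht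
    simp only [hlog] at this
    simp only [h0, Pi.zero_apply] at this
    linarith

theorem contDiff_steadyMean : ContDiff ℝ 1 fun g : Xu × Xn → ℝ =>
    steadyMean U (designMatrix R₀ Q₀ g) := by
  by_cases hX : Nonempty (Xu × Xn)
  · obtain ⟨x₀⟩ := hX
    simp only [← fun g => (pinned_inv_mulVec_apply_self (designMatrix_mem_rowStochastic hR₀ hQ₀ g)
      (designMatrix_isIrreducible hR₀ hQ₀ hirr g) U x₀).1]
    exact contDiff_pinned_inv hR₀ hQ₀ hirr U x₀ x₀
  · rw [not_nonempty_iff] at hX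
    simpa [steadyMean] using contDiff_const

theorem contDiff_ipdMap : ContDiff ℝ 1 fun g : Xu × Xn → ℝ =>
    ipdMap U x₀ (designMatrix R₀ Q₀ g) := by
  simp only [← fun g => (pinned_inv_mulVec_apply_self (designMatrix_mem_rowStochastic hR₀ hQ₀ g)
    (designMatrix_isIrreducible hR₀ hQ₀ hirr g) U x₀).2]
  exact contDiff_pi.2 fun x => (contDiff_pinned_inv hR₀ hQ₀ hirr U x₀ x).add
    (contDiff_pinned_inv hR₀ hQ₀ hirr U x₀ x₀).neg

theorem existsUnique_isIPDSolution : ∃! h, IsIPDSolution R₀ Q₀ U x₀ h := by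
  obtain ⟨C, hC, hbd⟩ := exists_norm_le_of_aroe hR₀ hQ₀ hirr U x₀
  refine existsUnique_global_solution (contDiff_ipdMap hR₀ hQ₀ hirr (U := U) (x₀ := x₀)) hC
    fun h T h0 hh t ht => ?_
  have := aroe_of_integralCurve hR₀ hQ₀ hirr h0 hh ht
  exact hbd t _ (h t) this.2 this.1

end Trajectory

end IPD

theorem theorem1 {Xu Xn : Type*} [Fintype Xu] [Fintype Xn] [DecidableEq Xu] [DecidableEq Xn]
    (R₀ : Xu × Xn → Xu → ℝ) (Q₀ : Xu × Xn → Xn → ℝ)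
    (hR₀ : ∀ x, R₀ x ∈ stdSimplex ℝ Xu) (hQ₀ : ∀ x, Q₀ x ∈ stdSimplex ℝ Xn)
    (hirr : (IPD.product R₀ Q₀).IsIrreducible) (haper : IPD.IsAperiodic (IPD.product R₀ Q₀))
    (U : Xu × Xn → ℝ) (x₀ : Xu × Xn) :
    -- the ODE has exactly one solution on the whole line
    (∃! h : ℝ → Xu × Xn → ℝ, IPD.IsIPDSolution R₀ Q₀ U x₀ h) ∧
    ∀ h : ℝ → Xu × Xn → ℝ, IPD.IsIPDSolution R₀ Q₀ U x₀ h →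
      let P : ℝ → Matrix (Xu × Xn) (Xu × Xn) ℝ := fun ζ => IPD.designMatrix R₀ Q₀ (h ζ)
      let η : ℝ → ℝ := IPD.optimalReward R₀ Q₀ U
      let Ubar : ℝ → ℝ := fun ζ => IPD.steadyMean U (P ζ)
      -- the design is well defined: transition matrices, and Poisson's equation
      ContDiff ℝ 1 (fun ζ => IPD.average Q₀ (h ζ)) ∧
      (∀ ζ, P ζ ∈ Matrix.rowStochastic ℝ (Xu × Xn) ∧ (P ζ).IsIrreducible ∧
        IPD.IsAperiodic (P ζ) ∧ (∃! π, IPD.IsInvariantPmf (P ζ) π) ∧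
        IsUnit (IPD.preFundamental (P ζ)) ∧
        ∀ H : Xu × Xn → ℝ,
          (H x₀ = 0 ∧ ∀ x, ((P ζ).mulVec H) x = H x - U x + Ubar ζ) ↔
            H = IPD.ipdMap U x₀ (P ζ)) ∧
      -- (i) `P ζ` is the unique maximizer, and the maximal value `η ζ` is attained
      (∀ ζ, IsGreatest (IPD.objective (IPD.product R₀ Q₀) U ζ '' IPD.feasible Q₀) (η ζ : EReal) ∧
        IPD.optimalMatrices R₀ Q₀ U ζ = {P ζ}) ∧
      -- (ii) the tilting function is the `Q₀`-average of the relative value function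
      (∀ ζ, ∃ hstar : Xu × Xn → ℝ,
        (hstar x₀ = 0 ∧ IPD.SolvesAROE R₀ Q₀ U ζ hstar (η ζ)) ∧
        (∀ g : Xu × Xn → ℝ,
          g x₀ = 0 ∧ IPD.SolvesAROE R₀ Q₀ U ζ g (η ζ) → g = hstar) ∧
        ∀ x u, IPD.average Q₀ (h ζ) x u = ∑ n, Q₀ x n * hstar (u, n)) ∧
      -- (iii) derivative of the steady-state mean power, and monotonicity
      (Differentiable ℝ η ∧ Differentiable ℝ (deriv η) ∧
        (∀ ζ, HasDerivAt Ubar (iteratedDeriv 2 η ζ) ζ ∧ 0 ≤ iteratedDeriv 2 η ζ) ∧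
        Monotone Ubar) := by
  have : Nonempty (Xu × Xn) := ⟨x₀⟩
  refine ⟨IPD.existsUnique_isIPDSolution hR₀ hQ₀ hirr, ?_⟩
  intro h hh P η Ubar
  obtain ⟨h0, hd⟩ := hh
  have haroe : ∀ ζ, h ζ x₀ = 0 ∧ ∀ x, ζ * U x + IPD.logPartition R₀ Q₀ (h ζ) x
      = h ζ x + (ζ * U x₀ + IPD.logPartition R₀ Q₀ (h ζ) x₀ - h ζ x₀) := fun ζ =>
    IPD.aroe_of_integralCurve hR₀ hQ₀ hirr h0 (T := |ζ| + 1) (fun t _ => hd t)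
      (abs_lt.1 (lt_add_one _))
  have hη : η = fun ζ => ζ * U x₀ + IPD.logPartition R₀ Q₀ (h ζ) x₀ - h ζ x₀ :=
    funext fun ζ => IPD.optimalReward_eq hR₀ hQ₀ (haroe ζ).2
  have haroe' : ∀ ζ x, ζ * U x + IPD.logPartition R₀ Q₀ (h ζ) x = h ζ x + η ζ := fun ζ => by
    rw [hη]
    exact (haroe ζ).2
  have hηd : ∀ ζ, HasDerivAt η (Ubar ζ) ζ := fun ζ => by
    rw [hη]
    exact IPD.hasDerivAt_reward hR₀ hQ₀ hirr (hd ζ) x₀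
  have hderiv : deriv η = Ubar := funext fun ζ => (hηd ζ).deriv
  have hdiff : Differentiable ℝ h := fun ζ => (hd ζ).differentiableAt
  have hhC : ContDiff ℝ 1 h := by
    refine contDiff_one_iff_deriv.2 ⟨hdiff, ?_⟩
    rw [funext fun ζ => (hd ζ).deriv]
    exact (IPD.contDiff_ipdMap hR₀ hQ₀ hirr).continuous.comp hdiff.continuous
  have hUd : Differentiable ℝ Ubar :=
    ((IPD.contDiff_steadyMean hR₀ hQ₀ hirr (U := U)).comp hhC).differentiable one_ne_zero
  have hmono : Monotone Ubar := by
    intro a b hab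
    -- Adding the subgradient inequalities at a and b gives (b - a)(Ubar b - Ubar a) ≥ 0.
    have h1 := IPD.add_mul_steadyMean_le hR₀ hQ₀ (haroe' a) (haroe' b)
    have h2 := IPD.add_mul_steadyMean_le hR₀ hQ₀ (haroe' b) (haroe' a)
    change η a + (b - a) * Ubar a ≤ η b at h1
    change η b + (a - b) * Ubar b ≤ η a at h2
    rcases hab.eq_or_lt with rfl | hlt
    · exact le_rfl
    · refine le_of_mul_le_mul_left ?_ (sub_pos.2 hlt)
      linarith
  have hiter : iteratedDeriv 2 η = deriv Ubar := by
    rw [iteratedDeriv_succ, iteratedDeriv_one, hderiv]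
  refine ⟨?_, fun ζ => ?_, fun ζ => ?_, fun ζ => ?_, fun ζ => (hηd ζ).differentiableAt, ?_,
    fun ζ => ?_, hmono⟩
  · refine contDiff_pi.2 fun x => contDiff_pi.2 fun u => ?_
    exact ContDiff.sum fun n _ => contDiff_const.mul (contDiff_pi.1 hhC (u, n))
  · have hP := IPD.designMatrix_mem_rowStochastic hR₀ hQ₀ (h ζ)
    have hPirr := IPD.designMatrix_isIrreducible hR₀ hQ₀ hirr (h ζ)
    exact ⟨hP, hPirr, (IPD.isAperiodic_congr (IPD.product_nonneg hR₀ hQ₀)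
      (IPD.designMatrix_nonneg hR₀ hQ₀ (h ζ)) (IPD.designMatrix_pos_iff (h ζ))).1 haper,
      IPD.existsUnique_isInvariantPmf hP hPirr, IPD.isUnit_preFundamental hP hPirr,
      IPD.poisson_iff_eq_ipdMap hP hPirr U x₀⟩
  · exact ⟨IPD.isGreatest_objective hR₀ hQ₀ (haroe' ζ),
      IPD.optimalMatrices_eq hR₀ hQ₀ hirr (haroe' ζ)⟩
  -- The relative value function is the ODE solution itself.
  · refine ⟨h ζ, ⟨(haroe ζ).1, (IPD.solvesAROE_iff hR₀ hQ₀).2 (haroe' ζ)⟩, ?_, fun _ _ => rfl⟩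
    rintro g ⟨hg0, hg⟩
    exact IPD.aroe_unique hR₀ hQ₀ hirr (haroe' ζ) ((IPD.solvesAROE_iff hR₀ hQ₀).1 hg)
      (hg0.trans (haroe ζ).1.symm)
  · rw [hderiv]
    exact hUd
  · rw [hiter]
    exact ⟨(hUd ζ).hasDerivAt, hmono.deriv_nonneg⟩
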